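/- Let $F$ be a field of characteristic $p>0$, let $q\in F^\times$, and suppose that the quantum characteristic $e$ of $q$, that is, the least $e\ge 1$ with $1+q+\dots+q^{e-1}=0$, exists (then $e>1$). Let $n\ge 1$ and let $\mathcal H_n=\mathcal H_n(F,q)$ be the Iwahori--Hecke algebra of the symmetric group $\mathfrak S_n$: the associative unital $F$-algebra with generators $T_1,\dots,T_{n-1}$ and relations $(T_i-q)(T_i+1)=0$, $T_iT_j=T_jT_i$ for $|i-j|>1$, and $T_iT_{i+1}T_i=T_{i+1}T_iT_{i+1}$. It has the basis $T_w=T_{i_1}\cdots T_{i_t}$, $w\in\mathfrak S_n$, where $w=s_{i_1}\cdots s_{i_t}$ is a reduced expression in the elementary transpositions. For a composition $\mu$ of $n$ let $\mathfrak S_\mu$ be the corresponding parabolic subgroup of $\mathfrak S_n$, and put $\mathcal H_\mu=\langle T_w: w\in\mathfrak S_\mu\rangle$ and $m_\mu=\sum_{w\in\mathfrak S_\mu}T_w$. For a partition $\mu$ of $n$ the Specht module $S^\mu$ is the right submodule of $\mathcal H_n/\check{\mathcal H}^\mu$ generated by $m_\mu+\check{\mathcal H}^\mu$, where $\check{\mathcal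 H}^\mu$ is the two-sided ideal generated by the $m_\nu$ for the partitions $\nu$ of $n$ that strictly dominate $\mu$. A right $\mathcal H_n$-module $M$ is relatively $\mathcal H_\mu$-projective if, for all right $\mathcal H_n$-modules $V,W$, every surjective $\mathcal H_n$-map $\beta:V\to W$ and every $\mathcal H_n$-map $\alpha:M\to W$, the existence of an $\mathcal H_\mu$-map $\gamma:M\to V$ with $\beta\gamma=\alpha$ implies the existence of an $\mathcal H_n$-map with this property. The subgroup $\mathfrak S_\mu$ is a vertex of $M$ if $M$ is relatively $\mathcal H_\mu$-projective and, for every composition $\nu$ of $n$ such that $M$ is relatively $\mathcal H_\nu$-projective, some conjugate of $\mathfrak S_\mu$ in $\mathfrak S_n$ is contained in $\mathfrak S_\nu$. Write $n=a_{-1}+a_0e+a_1ep+\dots+a_tep^t$ with $0\le a_{-1}<e$ and $0\le a_i<p$ for $i\ge 0$, and let $\lambda$ be the composition $$\lambda=\bigl(1^{a_{-1}},e^{a_0},(ep)^{a_1},\dots,(ep^t)^{a_t}\bigr)$$ of $n$, so that $\mathfrak S_\lambda$ is the standard maximal $e$-$p$-parabolic subgroup of $\mathfrak S_n$. Then $S^{(1^n)}$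 is the sign module of $\mathcal H_n$ (it is one-dimensional over $F$ and every $T_i$ acts on it as $-1$), and $\mathfrak S_\lambda$ is a vertex of $S^{(1^n)}$. -/

import Mathlib

universe u

namespace IwahoriHecke

open MulOpposite

/-! ### The Iwahori–Hecke algebra of type `A_{n-1}` -/

section Algebra

variable (F : Type u) [Field F] (n : ℕ) (q : F)

/-- The defining relations of the Hecke algebra. The generators are indexed by `Fin (n - 1)`,
the index `i` standing for the generator usually written `T_{i+1}`. -/
inductive Rel : FreeAlgebra F (Fin (n - 1)) → FreeAlgebra F (Fin (n - 1)) → Prop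
  | quadratic (i : Fin (n - 1)) :
      Rel ((FreeAlgebra.ι F i - algebraMap F _ q) * (FreeAlgebra.ι F i + 1)) 0
  | comm (i j : Fin (n - 1)) (h : (i : ℕ) + 1 < j ∨ (j : ℕ) + 1 < i) :
      Rel (FreeAlgebra.ι F i * FreeAlgebra.ι F j) (FreeAlgebra.ι F j * FreeAlgebra.ι F i)
  | braid (i j : Fin (n - 1)) (h : (j : ℕ) = i + 1) :
      Rel (FreeAlgebra.ι F i * FreeAlgebra.ι F j * FreeAlgebra.ι F i)
        (FreeAlgebra.ι F j * FreeAlgebra.ι F i * FreeAlgebra.ι F j)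

/-- The Hecke algebra `H_n(F, q)`, by generators and relations. -/
def Hecke : Type u := RingQuot (Rel F n q)

noncomputable instance : Ring (Hecke F n q) := inferInstanceAs (Ring (RingQuot (Rel F n q)))

noncomputable instance : Algebra F (Hecke F n q) :=
  inferInstanceAs (Algebra F (RingQuot (Rel F n q)))

/-- The generator of `H_n(F, q)` with index `i`. -/
noncomputable def gen (i : Fin (n - 1)) : Hecke F n q :=
  RingQuot.mkAlgHom F (Rel F n q) (FreeAlgebra.ι F i)

end Algebra

/-! ### Reduced expressions in the symmetric group -/

/-- The elementary transposition of `i` and `i + 1`. -/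
def simpleTransposition (n : ℕ) (i : Fin (n - 1)) : Equiv.Perm (Fin n) :=
  Equiv.swap ⟨i, by omega⟩ ⟨i + 1, by omega⟩

/-- The list `l` of indices spells a reduced expression for `w`: the product of the
corresponding elementary transpositions is `w`, and no shorter list has this product. -/
def IsReducedWord {n : ℕ} (l : List (Fin (n - 1))) (w : Equiv.Perm (Fin n)) : Prop :=
  (l.map (simpleTransposition n)).prod = w ∧
    ∀ l' : List (Fin (n - 1)), (l'.map (simpleTransposition n)).prod = w → l.length ≤ l'.length

theorem exists_word {n : ℕ} (w : Equiv.Perm (Fin n)) :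
    ∃ l : List (Fin (n - 1)), (l.map (simpleTransposition n)).prod = w := by
  cases n with
  | zero => exact ⟨[], Subsingleton.elim _ _⟩
  | succ m =>
    have hw : w ∈ Submonoid.closure
        (Set.range fun i : Fin m ↦ Equiv.swap i.castSucc i.succ) := by
      rw [Equiv.Perm.mclosure_swap_castSucc_succ]; trivial
    induction hw using Submonoid.closure_induction with
    | mem x hx =>
      obtain ⟨i, rfl⟩ := hx
      exact ⟨[i], by simp only [List.map_cons, List.map_nil, List.prod_singleton]; rfl⟩
    | one => exact ⟨[], rfl⟩
    | mul x y _ _ hx hy =>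
      obtain ⟨l, rfl⟩ := hx
      obtain ⟨l', rfl⟩ := hy
      exact ⟨l ++ l', by simp⟩

theorem exists_isReducedWord {n : ℕ} (w : Equiv.Perm (Fin n)) :
    ∃ l : List (Fin (n - 1)), IsReducedWord l w := by
  classical
  have h : ∃ k, ∃ l : List (Fin (n - 1)),
      (l.map (simpleTransposition n)).prod = w ∧ l.length = k := by
    obtain ⟨l, hl⟩ := exists_word w
    exact ⟨l.length, l, hl, rfl⟩
  obtain ⟨l, hl, hk⟩ := Nat.find_spec h
  exact ⟨l, hl, fun l' hl' ↦ by rw [hk]; exact Nat.find_min' h ⟨l', hl', rfl⟩⟩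

/-- A reduced expression for `w`. -/
noncomputable def reducedWord {n : ℕ} (w : Equiv.Perm (Fin n)) : List (Fin (n - 1)) :=
  (exists_isReducedWord w).choose

/-! ### Parabolic subgroups and parabolic subalgebras -/

/-- The parabolic subgroup `S_μ` of the symmetric group that belongs to a composition `μ` of `n`:
the permutations that preserve each of the consecutive blocks of sizes `μ_1, μ_2, …`. -/
def parabolic {n : ℕ} (μ : Composition n) : Subgroup (Equiv.Perm (Fin n)) where
  carrier := {w | ∀ i, μ.index (w i) = μ.index i}
  one_mem' := fun _ ↦ rfl
  mul_mem' := fun {a b} ha hb i ↦ by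
    rw [Equiv.Perm.mul_apply, ha, hb]
  inv_mem' := fun {a} ha i ↦ by
    have h := ha (a⁻¹ i)
    have h' : a (a⁻¹ i) = i := a.apply_symm_apply i
    rw [h'] at h
    exact h.symm

section Modules

variable (F : Type u) [Field F] {n : ℕ} (q : F)

/-- The basis element `T_w = T_{i_1} ⋯ T_{i_t}` where `s_{i_1} ⋯ s_{i_t}` is a reduced expression
for `w` (it does not depend on the reduced expression, by the braid relations). -/
noncomputable def basisT (w : Equiv.Perm (Fin n)) : Hecke F n q :=
  ((reducedWord w).map (gen F n q)).prod

/-- The parabolic subalgebra `H_μ = ⟨T_w : w ∈ S_μ⟩` of `H_n`. -/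
noncomputable def parabolicSubalgebra (μ : Composition n) : Subalgebra F (Hecke F n q) :=
  Algebra.adjoin F {x | ∃ w ∈ parabolic μ, x = basisT F q w}

end Modules

/-! ### Relative projectivity and vertices; right `A`-modules are `Aᵐᵒᵖ`-modules -/

/-- The right `A`-module `M` is relatively `A'`-projective: given right `A`-modules `V`, `W`, a
surjective `A`-map `β : V → W` and an `A`-map `α : M → W`, if `α` factors through `β` by an
`A'`-map, then it factors through `β` by an `A`-map. -/
def IsRelativelyProjective {F A : Type u} [Field F] [Ring A] [Algebra F A]
    (A' : Subalgebra F A) (M : Type u) [AddCommGroup M] [Module Aᵐᵒᵖ M] : Prop :=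
  ∀ (V W : Type u) [AddCommGroup V] [Module Aᵐᵒᵖ V] [AddCommGroup W] [Module Aᵐᵒᵖ W]
    (β : V →ₗ[Aᵐᵒᵖ] W) (α : M →ₗ[Aᵐᵒᵖ] W), Function.Surjective β →
    (∃ γ : M →ₗ[A'.op] V, ∀ m, β (γ m) = α m) →
    ∃ γ : M →ₗ[Aᵐᵒᵖ] V, ∀ m, β (γ m) = α m

/-- `S_μ` is a vertex of the right `H_n`-module `M`: `M` is relatively `H_μ`-projective, and
whenever `M` is relatively `H_ν`-projective, some conjugate of `S_μ` is contained in `S_ν`. -/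
def IsVertex (F : Type u) [Field F] {n : ℕ} (q : F) (M : Type u) [AddCommGroup M]
    [Module (Hecke F n q)ᵐᵒᵖ M] (μ : Composition n) : Prop :=
  IsRelativelyProjective (parabolicSubalgebra F q μ) M ∧
    ∀ ν : Composition n, IsRelativelyProjective (parabolicSubalgebra F q ν) M →
      ∃ x : Equiv.Perm (Fin n),
        (parabolic μ).map (MulAut.conj x).toMonoidHom ≤ parabolic ν

/-! ### Specht modules -/

/-- The composition `μ` is a partition: its parts are weakly decreasing. -/
def IsPartition {n : ℕ} (μ : Composition n) : Prop := μ.blocks.Pairwise (· ≥ ·)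

/-- `ν` strictly dominates `μ`. -/
def StrictlyDominates {n : ℕ} (ν μ : Composition n) : Prop :=
  ν ≠ μ ∧ ∀ k, (μ.blocks.take k).sum ≤ (ν.blocks.take k).sum

section Specht

variable (F : Type u) [Field F] {n : ℕ} (q : F)

open Classical in
/-- `m_μ = ∑_{w ∈ S_μ} T_w`. -/
noncomputable def mElt (μ : Composition n) : Hecke F n q :=
  ∑ w : parabolic μ, basisT F q (w : Equiv.Perm (Fin n))

/-- The two-sided ideal of `H_n` generated by the `m_ν` with `ν` a partition that strictly
dominates `μ`, as the right ideal generated by all `h * m_ν`. (For `q ≠ 0` it has the Murphy basis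
`T_{d(𝔲)}^* m_ν T_{d(𝔳)}` with `𝔲, 𝔳` standard `ν`-tableaux and `ν` as above.) -/
noncomputable def dominatingIdeal (μ : Composition n) :
    Submodule (Hecke F n q)ᵐᵒᵖ (Hecke F n q) :=
  Submodule.span (Hecke F n q)ᵐᵒᵖ
    {x | ∃ ν : Composition n, IsPartition ν ∧ StrictlyDominates ν μ ∧
      ∃ h : Hecke F n q, x = h * mElt F q ν}

/-- The Specht module `S^μ` (for a partition `μ`): the right submodule generated by the coset of
`m_μ` in the quotient of `H_n` by the ideal of the partitions that strictly dominate `μ`. -/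
abbrev Specht (μ : Composition n) : Type u :=
  Submodule.span (Hecke F n q)ᵐᵒᵖ
    {(Submodule.Quotient.mk (mElt F q μ) : Hecke F n q ⧸ dominatingIdeal F q μ)}

end Specht

/-! ### Quantum characteristic and the `e`-`p`-adic expansion -/

/-- The quantum characteristic: the least `e ≥ 1` with `1 + q + ⋯ + q^{e-1} = 0`, and `0` if there
is none (the infimum of the empty set of natural numbers is `0`). -/
noncomputable def quantumChar {F : Type u} [Field F] (q : F) : ℕ :=
  sInf {k : ℕ | 0 < k ∧ ∑ i ∈ Finset.range k, q ^ i = 0}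

/-- For a list of digits `[a_0, a_1, a_2, …]` the list of parts
`(m^{a_0}, (m p)^{a_1}, (m p^2)^{a_2}, …)`. -/
def digitBlocks (p : ℕ) : ℕ → List ℕ → List ℕ
  | _, [] => []
  | m, a :: l => List.replicate a m ++ digitBlocks p (m * p) l

theorem sum_digitBlocks (p : ℕ) (l : List ℕ) (m : ℕ) :
    (digitBlocks p m l).sum = m * Nat.ofDigits p l := by
  induction l generalizing m with
  | nil => simp [digitBlocks]
  | cons a l ih =>
    simp only [digitBlocks, List.sum_append, List.sum_replicate, smul_eq_mul, ih,
      Nat.ofDigits_cons]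
    ring

theorem digitBlocks_pos {p : ℕ} (hp : 0 < p) (l : List ℕ) {m : ℕ} (hm : 0 < m) {i : ℕ}
    (hi : i ∈ digitBlocks p m l) : 0 < i := by
  induction l generalizing m with
  | nil => simp [digitBlocks] at hi
  | cons a l ih =>
    rw [digitBlocks, List.mem_append] at hi
    rcases hi with hi | hi
    · rw [List.eq_of_mem_replicate hi]; exact hm
    · exact ih (Nat.mul_pos hm hp) hi

/-- The composition `(1^{a_{-1}}, e^{a_0}, (ep)^{a_1}, …, (ep^t)^{a_t})` of
`n = a_{-1} + a_0 e + a_1 ep + ⋯ + a_t ep^t` with `0 ≤ a_{-1} < e` and `0 ≤ a_i < p`. Here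
`a_{-1}` is the remainder of `n` on division by `e`, and `a_0, …, a_t` are the base `p` digits of
the quotient, least significant first. -/
def standardMaximal (e p n : ℕ) (he : 0 < e) (hp : 0 < p) : Composition n where
  blocks := List.replicate (n % e) 1 ++ digitBlocks p e (Nat.digits p (n / e))
  blocks_pos := fun {i} hi ↦ by
    rcases List.mem_append.1 hi with hi | hi
    · rw [List.eq_of_mem_replicate hi]; exact Nat.one_pos
    · exact digitBlocks_pos hp _ he hi
  blocks_sum := by
    rw [List.sum_append, sum_digitBlocks, Nat.ofDigits_digits, List.sum_replicate, smul_eq_mul,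
      mul_one, Nat.mod_add_div]

end IwahoriHecke

/-! The sign module is relatively `H_ν`-projective exactly when the Gaussian multinomial coefficient
of `ν` at `q⁻¹` is nonzero in `F` (`isRelativelyProjective_specht_iff`, `inversionSum_index`). What
remains is arithmetic of digits.

The cosets `S_ν w` are encoded by words: `w` goes to the rearrangement `ν.index ∘ w` of the sorted
word `ν.index`. The length of the shortest coset representative `d` is the number of inversions of
the word, and `wordT` is `T_d`. If the coefficient is nonzero, an `H_ν`-lift `γ` is replaced by its
relative trace: `γ x` is a sign vector for `H_ν`, so its image under `∑ (-q⁻¹)^{ℓ(d)} T_d` is a sign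
vector for `H_n`. On the sign module this element acts by `∑ q^{-ℓ(d)}`, the multinomial
coefficient, which can be divided out. Conversely, the module induced from the sign module of `H_ν`
maps onto the sign module, and this surjection has an `H_ν`-splitting. The sign vectors in the
induced module are explicit, and their images are multiples of the same coefficient, so an
`H_n`-splitting forces it to be nonzero.

By the quantum and the classical Lucas theorems (`qBinom_lucas`, `digitParts_add`) the coefficient
is nonzero only if the parts of `ν` add up to `n` without carries in the `e`-`p`-adic expansion. The
standard parts of `n` are then distributed among the parts of `ν` (`standardParts_sum`), which puts
a conjugate of `S_λ` inside `S_ν` (`exists_conj_parabolic_le`). For `ν = λ` no carries occur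
(`qMultinom_standardMaximal_ne_zero`).

The Specht module of `(1^n)` is `H_n` modulo an ideal that contains every `T_i + 1` and lies in the
kernel of the sign character, hence it is the sign module. -/

namespace IwahoriHecke

/-! ### Words, inversions and descents -/

section Words

variable {n : ℕ} {α : Type*}

/-- The smaller of the two points moved by the elementary transposition with index `i`. -/
def lo (i : Fin (n - 1)) : Fin n := ⟨i, by omega⟩

/-- The larger of the two points moved by the elementary transposition with index `i`. -/
def hi (i : Fin (n - 1)) : Fin n := ⟨i + 1, by omega⟩

theorem simpleTransposition_apply (i : Fin (n - 1)) (a : Fin n) :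
    simpleTransposition n i a = if a = lo i then hi i else if a = hi i then lo i else a :=
  Equiv.swap_apply_def _ _ _

theorem lo_ne_hi (i : Fin (n - 1)) : lo i ≠ hi i := by
  simp [lo, hi, Fin.ext_iff]

theorem lo_lt_hi (i : Fin (n - 1)) : lo i < hi i := by
  simp [lo, hi, Fin.lt_def]

@[simp] theorem simpleTransposition_lo (i : Fin (n - 1)) :
    simpleTransposition n i (lo i) = hi i := Equiv.swap_apply_left _ _

@[simp] theorem simpleTransposition_hi (i : Fin (n - 1)) :
    simpleTransposition n i (hi i) = lo i := Equiv.swap_apply_right _ _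

@[simp] theorem simpleTransposition_involutive (i : Fin (n - 1)) (a : Fin n) :
    simpleTransposition n i (simpleTransposition n i a) = a := by
  rw [← Equiv.Perm.mul_apply, simpleTransposition, Equiv.swap_mul_self, Equiv.Perm.one_apply]

theorem simpleTransposition_mul_self (i : Fin (n - 1)) :
    simpleTransposition n i * simpleTransposition n i = 1 := Equiv.swap_mul_self _ _

theorem simpleTransposition_ne_one (i : Fin (n - 1)) : simpleTransposition n i ≠ 1 := by
  intro h
  have := simpleTransposition_lo i
  rw [h] at this
  exact lo_ne_hi i this

theorem simpleTransposition_injective : Function.Injective (simpleTransposition n) := by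
  intro i j h
  have h1 := simpleTransposition_lo i
  rw [h, simpleTransposition_apply] at h1
  apply Fin.ext
  split_ifs at h1 with h2 h3
  · exact Fin.mk.inj h2
  · have h4 := congrArg Fin.val h1
    have h5 := congrArg Fin.val h3
    simp only [lo, hi] at h4 h5
    omega
  · exact absurd h1 (lo_ne_hi i)

theorem simpleTransposition_lo_of_far {i j : Fin (n - 1)}
    (h : (i : ℕ) + 1 < j ∨ (j : ℕ) + 1 < i) : simpleTransposition n i (lo j) = lo j := by
  rw [simpleTransposition_apply, if_neg, if_neg]
  all_goals simp only [lo, hi, Fin.ext_iff]; omega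

theorem simpleTransposition_hi_of_far {i j : Fin (n - 1)}
    (h : (i : ℕ) + 1 < j ∨ (j : ℕ) + 1 < i) : simpleTransposition n i (hi j) = hi j := by
  rw [simpleTransposition_apply, if_neg, if_neg]
  all_goals simp only [lo, hi, Fin.ext_iff]; omega

theorem lo_of_succ {i j : Fin (n - 1)} (h : (j : ℕ) = i + 1) : lo j = hi i :=
  Fin.ext h

theorem simpleTransposition_hi_succ {i j : Fin (n - 1)} (h : (j : ℕ) = i + 1) :
    simpleTransposition n i (hi j) = hi j := by
  rw [simpleTransposition_apply, if_neg, if_neg]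
  all_goals simp only [lo, hi, Fin.ext_iff]; omega

theorem simpleTransposition_lo_pred {i j : Fin (n - 1)} (h : (j : ℕ) = i + 1) :
    simpleTransposition n j (lo i) = lo i := by
  rw [simpleTransposition_apply, if_neg, if_neg]
  all_goals simp only [lo, hi, Fin.ext_iff]; omega

theorem mul_simpleTransposition (w : Equiv.Perm (Fin n)) (i : Fin (n - 1)) :
    w * simpleTransposition n i = Equiv.swap (w (lo i)) (w (hi i)) * w :=
  Equiv.mul_swap_eq_swap_mul _ _ _

theorem simpleTransposition_comm {i j : Fin (n - 1)} (h : (i : ℕ) + 1 < j ∨ (j : ℕ) + 1 < i) :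
    simpleTransposition n i * simpleTransposition n j =
      simpleTransposition n j * simpleTransposition n i := by
  rw [mul_simpleTransposition, simpleTransposition_lo_of_far h, simpleTransposition_hi_of_far h]
  rfl

theorem simpleTransposition_braid {i j : Fin (n - 1)} (h : (j : ℕ) = i + 1) :
    simpleTransposition n i * simpleTransposition n j * simpleTransposition n i =
      simpleTransposition n j * simpleTransposition n i * simpleTransposition n j := by
  rw [mul_simpleTransposition _ j, mul_simpleTransposition (simpleTransposition n j) i,
    lo_of_succ h, simpleTransposition_hi, simpleTransposition_hi_succ h,
    simpleTransposition_lo_pred h, ← lo_of_succ h, simpleTransposition_lo, mul_assoc, mul_assoc,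
    simpleTransposition_mul_self, simpleTransposition_mul_self]

/-- Exchanging the letters in the places `i` and `i + 1` of a word. -/
def exch (f : Fin n → α) (i : Fin (n - 1)) : Fin n → α := f ∘ simpleTransposition n i

@[simp] theorem exch_lo (f : Fin n → α) (i : Fin (n - 1)) : exch f i (lo i) = f (hi i) := by
  simp [exch]

@[simp] theorem exch_hi (f : Fin n → α) (i : Fin (n - 1)) : exch f i (hi i) = f (lo i) := by
  simp [exch]

@[simp] theorem exch_exch (f : Fin n → α) (i : Fin (n - 1)) : exch (exch f i) i = f := by
  ext a; simp [exch]

theorem exch_of_eq {f : Fin n → α} {i : Fin (n - 1)} (h : f (lo i) = f (hi i)) :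
    exch f i = f := by
  ext a
  simp only [exch, Function.comp_apply, simpleTransposition_apply]
  split_ifs with h1 h2
  · rw [h1, h]
  · rw [h2, h]
  · rfl

theorem exch_ne {f : Fin n → α} {i : Fin (n - 1)} (h : f (lo i) ≠ f (hi i)) :
    exch f i ≠ f := by
  intro h'
  exact h (by rw [← exch_hi f i, h'])

theorem exch_comm (f : Fin n → α) {i j : Fin (n - 1)}
    (h : (i : ℕ) + 1 < j ∨ (j : ℕ) + 1 < i) : exch (exch f i) j = exch (exch f j) i := by
  have := simpleTransposition_comm h
  ext a
  exact congrArg f (DFunLike.congr_fun this a)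

theorem exch_braid (f : Fin n → α) {i j : Fin (n - 1)} (h : (j : ℕ) = i + 1) :
    exch (exch (exch f i) j) i = exch (exch (exch f j) i) j := by
  have := simpleTransposition_braid h
  ext a
  exact congrArg f (DFunLike.congr_fun this a)

theorem exch_lo_of_far (f : Fin n → α) {i j : Fin (n - 1)}
    (h : (i : ℕ) + 1 < j ∨ (j : ℕ) + 1 < i) : exch f i (lo j) = f (lo j) :=
  congrArg f (simpleTransposition_lo_of_far h)

theorem exch_hi_of_far (f : Fin n → α) {i j : Fin (n - 1)}
    (h : (i : ℕ) + 1 < j ∨ (j : ℕ) + 1 < i) : exch f i (hi j) = f (hi j) :=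
  congrArg f (simpleTransposition_hi_of_far h)

theorem exch_hi_succ (f : Fin n → α) {i j : Fin (n - 1)} (h : (j : ℕ) = i + 1) :
    exch f i (hi j) = f (hi j) :=
  congrArg f (simpleTransposition_hi_succ h)

theorem exch_lo_pred (f : Fin n → α) {i j : Fin (n - 1)} (h : (j : ℕ) = i + 1) :
    exch f j (lo i) = f (lo i) :=
  congrArg f (simpleTransposition_lo_pred h)

theorem exch_hi_pred (f : Fin n → α) {i j : Fin (n - 1)} (h : (j : ℕ) = i + 1) :
    exch f j (hi i) = f (hi j) := by
  rw [← lo_of_succ h, exch_lo]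

theorem exch_perm {f g : Fin n → α} (h : ∃ σ : Equiv.Perm (Fin n), f = g ∘ σ) (i : Fin (n - 1)) :
    ∃ σ : Equiv.Perm (Fin n), exch f i = g ∘ σ := by
  obtain ⟨σ, rfl⟩ := h
  exact ⟨σ * simpleTransposition n i, rfl⟩

variable [LinearOrder α]

/-- The number of inversions of a word. -/
def inversionCount (f : Fin n → α) : ℕ :=
  (Finset.univ.filter fun p : Fin n × Fin n => p.1 < p.2 ∧ f p.2 < f p.1).card

theorem simpleTransposition_lt_iff {i : Fin (n - 1)} {a b : Fin n}
    (h1 : ¬ (a = lo i ∧ b = hi i)) (h2 : ¬ (a = hi i ∧ b = lo i)) :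
    simpleTransposition n i a < simpleTransposition n i b ↔ a < b := by
  simp only [simpleTransposition_apply, lo, hi, Fin.ext_iff, Fin.lt_def] at *
  split_ifs <;> simp_all <;> omega

/-- Moving both places of a pair by the transposition carries the old inversions to inversions of
the new word; the only one not obtained this way is the pair of exchanged places itself. -/
theorem inversionCount_exch {f : Fin n → α} {i : Fin (n - 1)} (h : f (lo i) < f (hi i)) :
    inversionCount (exch f i) = inversionCount f + 1 := by
  unfold inversionCount
  set s := simpleTransposition n i with hs
  have hsymm : s.symm = s := Equiv.symm_swap _ _
  have key : (Finset.univ.filter fun p : Fin n × Fin n =>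
      p.1 < p.2 ∧ exch f i p.2 < exch f i p.1) =
      insert (lo i, hi i) ((Finset.univ.filter fun p : Fin n × Fin n =>
        p.1 < p.2 ∧ f p.2 < f p.1).map (s.prodCongr s).toEmbedding) := by
    ext ⟨a, b⟩
    simp only [Finset.mem_filter, Finset.mem_univ, true_and, Finset.mem_insert,
      Finset.mem_map_equiv, Prod.mk.injEq, Equiv.prodCongr_symm, Equiv.prodCongr_apply,
      Prod.map_apply, hsymm]
    change (a < b ∧ f (s b) < f (s a)) ↔ _
    by_cases h1 : a = lo i ∧ b = hi i
    · obtain ⟨rfl, rfl⟩ := h1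
      simp [hs, h, lo_lt_hi]
    by_cases h2 : a = hi i ∧ b = lo i
    · obtain ⟨rfl, rfl⟩ := h2
      simp [hs, h.le, (lo_ne_hi i).symm]
    · simp only [h1, false_or, hs, simpleTransposition_lt_iff h1 h2]
  rw [key, Finset.card_insert_of_notMem, Finset.card_map]
  simp only [Finset.mem_map_equiv, Equiv.prodCongr_symm, Equiv.prodCongr_apply, Prod.map_apply,
    hsymm]
  simp [hs, (lo_lt_hi i).le]

theorem inversionCount_exch' {f : Fin n → α} {i : Fin (n - 1)} (h : f (hi i) < f (lo i)) :
    inversionCount f = inversionCount (exch f i) + 1 := by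
  rw [← inversionCount_exch (f := exch f i) (i := i) (by simpa using h), exch_exch]

theorem monotone_of_lo_le_hi {f : Fin n → α} (h : ∀ i, f (lo i) ≤ f (hi i)) : Monotone f := by
  cases n with
  | zero => exact fun a => a.elim0
  | succ m => exact Fin.monotone_iff_le_succ.2 h

theorem inversionCount_of_monotone {f : Fin n → α} (h : Monotone f) : inversionCount f = 0 := by
  simp only [inversionCount, Finset.card_eq_zero, Finset.filter_eq_empty_iff]
  rintro ⟨a, b⟩ - ⟨h1, h2⟩
  exact absurd h2 (not_lt.2 (h h1.le))

theorem eq_of_monotone_of_perm {f g : Fin n → α} (hf : Monotone f) (hg : Monotone g)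
    (h : ∃ σ : Equiv.Perm (Fin n), f = g ∘ σ) : f = g := by
  obtain ⟨σ, rfl⟩ := h
  exact Tuple.unique_monotone (f := g) (σ := σ) (τ := 1) hf hg

/-- Functions with fibres of the same sizes differ by a bijection of the domains. -/
theorem exists_equiv_of_card_fiber {ι ι' κ : Type*} [Fintype ι] [Fintype ι'] [DecidableEq κ]
    {f : ι → κ} {g : ι' → κ} (h : ∀ c, (Finset.univ.filter fun a => f a = c).card =
      (Finset.univ.filter fun a => g a = c).card) : ∃ σ : ι ≃ ι', ∀ a, f a = g (σ a) := by
  have e : ∀ c, Nonempty ({a // f a = c} ≃ {a // g a = c}) := fun c =>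
    Fintype.card_eq.1 (by rw [Fintype.card_subtype, Fintype.card_subtype, h])
  exact ⟨Equiv.ofFiberEquiv fun c => (e c).some, fun a => (Equiv.ofFiberEquiv_map _ a).symm⟩

end Words

/-! ### Reduced words -/

section Reduced

variable {n : ℕ}

theorem perm_exch (w : Equiv.Perm (Fin n)) (i : Fin (n - 1)) :
    exch (w : Fin n → Fin n) i = ⇑(w * simpleTransposition n i) := rfl

theorem inversionCount_le_length (l : List (Fin (n - 1))) :
    inversionCount (⇑((l.map (simpleTransposition n)).prod)) ≤ l.length := by
  induction l using List.reverseRecOn with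
  | nil => simp [inversionCount_of_monotone monotone_id, Equiv.Perm.coe_one]
  | append_singleton l i ih =>
    set w := (l.map (simpleTransposition n)).prod with hw
    have e : ((l ++ [i]).map (simpleTransposition n)).prod = w * simpleTransposition n i := by
      simp [hw]
    rw [e, ← perm_exch, List.length_append, List.length_singleton]
    clear_value w
    rcases lt_or_gt_of_ne (w.injective.ne (lo_ne_hi i)) with h | h
    · rw [inversionCount_exch h]; omega
    · have := inversionCount_exch' h; omega

/-- Bubble sort: each descent that is removed costs one letter and one inversion. Together with
`inversionCount_le_length` this identifies length with number of inversions. -/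
theorem exists_word_length (w : Equiv.Perm (Fin n)) : ∃ l : List (Fin (n - 1)),
    (l.map (simpleTransposition n)).prod = w ∧ l.length = inversionCount (⇑w) := by
  induction hk : inversionCount (⇑w) using Nat.strong_induction_on generalizing w with
  | _ k ih =>
    by_cases h : ∃ i, w (hi i) < w (lo i)
    · obtain ⟨i, hi'⟩ := h
      have h1 := inversionCount_exch' hi'
      rw [perm_exch] at h1
      obtain ⟨l, hl, hl'⟩ := ih _ (by omega) (w * simpleTransposition n i) rfl
      refine ⟨l ++ [i], ?_, by rw [List.length_append, List.length_singleton, hl']; omega⟩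
      simp [hl, mul_assoc, simpleTransposition_mul_self]
    · push Not at h
      have hm : Monotone w := monotone_of_lo_le_hi h
      have hw : ⇑w = id := eq_of_monotone_of_perm hm monotone_id ⟨w, rfl⟩
      have hw1 : w = 1 := Equiv.ext fun a => congrFun hw a
      subst hw1
      exact ⟨[], rfl, by rw [← hk, inversionCount_of_monotone hm]; rfl⟩

theorem IsReducedWord.length_eq {l : List (Fin (n - 1))} {w : Equiv.Perm (Fin n)}
    (h : IsReducedWord l w) : l.length = inversionCount (⇑w) := by
  obtain ⟨l', h1, h2⟩ := exists_word_length w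
  have := inversionCount_le_length l
  rw [h.1] at this
  have := h.2 l' h1
  omega

theorem IsReducedWord.of_append {l : List (Fin (n - 1))} {i : Fin (n - 1)}
    {w : Equiv.Perm (Fin n)} (h : IsReducedWord (l ++ [i]) w) :
    w (hi i) < w (lo i) ∧ IsReducedWord l (w * simpleTransposition n i) := by
  have hl : (l.map (simpleTransposition n)).prod = w * simpleTransposition n i := by
    rw [← h.1]; simp [mul_assoc, simpleTransposition_mul_self]
  have hlen := h.length_eq
  rw [List.length_append, List.length_singleton] at hlen
  have hle := inversionCount_le_length l
  rw [hl] at hle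
  refine ⟨?_, hl, fun l' hl' => ?_⟩
  · by_contra hc
    have hlt : w (lo i) < w (hi i) :=
      lt_of_le_of_ne (not_lt.1 hc) (w.injective.ne (lo_ne_hi i))
    have := inversionCount_exch hlt
    rw [perm_exch] at this
    omega
  · have := h.2 (l' ++ [i]) (by simp [hl', mul_assoc, simpleTransposition_mul_self])
    simpa using this

theorem index_monotone (ν : Composition n) : Monotone ν.index := by
  intro i j hij
  by_contra h
  push Not at h
  have h1 := ν.sizeUpTo_index_le i
  have h2 := ν.lt_sizeUpTo_index_succ j
  have h3 : ν.sizeUpTo (ν.index j).succ ≤ ν.sizeUpTo (ν.index i) :=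
    ν.monotone_sizeUpTo (Nat.succ_le_of_lt h)
  have h4 : (i : ℕ) ≤ j := hij
  omega

theorem simpleTransposition_mem_parabolic {ν : Composition n} {i : Fin (n - 1)}
    (h : ν.index (lo i) = ν.index (hi i)) : simpleTransposition n i ∈ parabolic ν :=
  fun a => congrFun (exch_of_eq h) a

/-- This makes `H_ν`, spanned by elements `T_w`, accessible through the generators `T_i` inside
blocks. The last letter of a reduced word is a descent of `w`; since `w` preserves blocks and
`index` is monotone, a descent cannot join two different blocks. That letter is removed and the
argument repeated. -/
theorem IsReducedWord.index_eq {ν : Composition n} {l : List (Fin (n - 1))}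
    {w : Equiv.Perm (Fin n)} (h : IsReducedWord l w) (hw : w ∈ parabolic ν) :
    ∀ i ∈ l, ν.index (lo i) = ν.index (hi i) := by
  induction l using List.reverseRecOn generalizing w with
  | nil => simp
  | append_singleton l i ih =>
    obtain ⟨h1, h2⟩ := h.of_append
    have hi' : ν.index (lo i) = ν.index (hi i) := by
      refine le_antisymm (index_monotone ν (lo_lt_hi i).le) ?_
      have := index_monotone ν h1.le
      rwa [hw, hw] at this
    intro j hj
    rcases List.mem_append.1 hj with hj | hj
    · exact ih h2 (mul_mem hw (simpleTransposition_mem_parabolic hi')) j hj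
    · rw [List.mem_singleton.1 hj, hi']

theorem isReducedWord_reducedWord (w : Equiv.Perm (Fin n)) : IsReducedWord (reducedWord w) w :=
  (exists_isReducedWord w).choose_spec

theorem IsReducedWord.eq_singleton {l : List (Fin (n - 1))} {i : Fin (n - 1)}
    (h : IsReducedWord l (simpleTransposition n i)) : l = [i] := by
  have h1 := h.2 [i] (by simp)
  have h2 := h.1
  match l with
  | [] => exact absurd h2.symm (simpleTransposition_ne_one i)
  | [j] => exact congrArg (fun a => [a]) (simpleTransposition_injective (by simpa using h2))
  | _ :: _ :: _ => simp at h1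

theorem reducedWord_simpleTransposition (i : Fin (n - 1)) :
    reducedWord (simpleTransposition n i) = [i] :=
  (isReducedWord_reducedWord _).eq_singleton

theorem reducedWord_one : reducedWord (1 : Equiv.Perm (Fin n)) = [] := by
  have h := (isReducedWord_reducedWord (1 : Equiv.Perm (Fin n))).2 [] rfl
  exact List.length_eq_zero_iff.1 (Nat.le_zero.1 h)

end Reduced

open MulOpposite

/-! ### The Hecke algebra: relations, induction, homomorphisms -/

section Basic

variable {F : Type u} [Field F] {n : ℕ} {q : F}

theorem gen_quadratic (i : Fin (n - 1)) :
    (gen F n q i - algebraMap F _ q) * (gen F n q i + 1) = 0 := by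
  have := RingQuot.mkAlgHom_rel F (Rel.quadratic (F := F) (q := q) i)
  simp only [map_mul, map_sub, map_add, map_one, map_zero, AlgHom.commutes] at this
  exact this

theorem gen_mul_gen (i : Fin (n - 1)) :
    gen F n q i * gen F n q i = q • 1 + (q - 1) • gen F n q i := by
  have := gen_quadratic (F := F) (q := q) i
  rw [Algebra.algebraMap_eq_smul_one, sub_mul, mul_add, mul_one, smul_mul_assoc, one_mul,
    sub_eq_zero] at this
  rw [sub_smul, one_smul, eq_sub_of_add_eq this, smul_add]
  abel

theorem gen_comm {i j : Fin (n - 1)} (h : (i : ℕ) + 1 < j ∨ (j : ℕ) + 1 < i) :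
    gen F n q i * gen F n q j = gen F n q j * gen F n q i := by
  have := RingQuot.mkAlgHom_rel F (Rel.comm (F := F) (q := q) i j h)
  simp only [map_mul] at this
  exact this

theorem gen_braid {i j : Fin (n - 1)} (h : (j : ℕ) = i + 1) :
    gen F n q i * gen F n q j * gen F n q i = gen F n q j * gen F n q i * gen F n q j := by
  have := RingQuot.mkAlgHom_rel F (Rel.braid (F := F) (q := q) i j h)
  simp only [map_mul] at this
  exact this

theorem Hecke.induction {P : Hecke F n q → Prop} (algebraMap : ∀ c, P (algebraMap F _ c))
    (gen : ∀ i, P (gen F n q i)) (mul : ∀ a b, P a → P b → P (a * b))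
    (add : ∀ a b, P a → P b → P (a + b)) (h : Hecke F n q) : P h := by
  obtain ⟨x, rfl⟩ := RingQuot.mkAlgHom_surjective F (Rel F n q) h
  induction x using FreeAlgebra.induction with
  | grade0 c => rw [AlgHom.commutes]; exact algebraMap c
  | grade1 i => exact gen i
  | mul a b ha hb => rw [map_mul]; exact mul _ _ ha hb
  | add a b ha hb => rw [map_add]; exact add _ _ ha hb

/-- The algebra homomorphism from the Hecke algebra given by elements that satisfy the
defining relations. -/
noncomputable def Hecke.lift {B : Type*} [Ring B] [Algebra F B] (t : Fin (n - 1) → B)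
    (hq : ∀ i, (t i - algebraMap F B q) * (t i + 1) = 0)
    (hc : ∀ i j : Fin (n - 1), ((i : ℕ) + 1 < j ∨ (j : ℕ) + 1 < i) → t i * t j = t j * t i)
    (hb : ∀ i j : Fin (n - 1), (j : ℕ) = i + 1 → t i * t j * t i = t j * t i * t j) :
    Hecke F n q →ₐ[F] B :=
  RingQuot.liftAlgHom F ⟨FreeAlgebra.lift F t, fun {x y} h => by
    induction h with
    | quadratic i =>
      simpa only [map_mul, map_sub, map_add, map_one, map_zero, AlgHom.commutes,
        FreeAlgebra.lift_ι_apply] using hq i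
    | comm i j h => simpa only [map_mul, FreeAlgebra.lift_ι_apply] using hc i j h
    | braid i j h => simpa only [map_mul, FreeAlgebra.lift_ι_apply] using hb i j h⟩

theorem Hecke.lift_gen {B : Type*} [Ring B] [Algebra F B] (t : Fin (n - 1) → B)
    (hq : ∀ i, (t i - algebraMap F B q) * (t i + 1) = 0)
    (hc : ∀ i j : Fin (n - 1), ((i : ℕ) + 1 < j ∨ (j : ℕ) + 1 < i) → t i * t j = t j * t i)
    (hb : ∀ i j : Fin (n - 1), (j : ℕ) = i + 1 → t i * t j * t i = t j * t i * t j)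
    (i : Fin (n - 1)) : Hecke.lift t hq hc hb (gen F n q i) = t i := by
  have h := RingQuot.liftAlgHom_mkAlgHom_apply F (s := Rel F n q) (f := FreeAlgebra.lift F t)
    (fun {x y} h => by
    induction h with
    | quadratic i =>
      simpa only [map_mul, map_sub, map_add, map_one, map_zero, AlgHom.commutes,
        FreeAlgebra.lift_ι_apply] using hq i
    | comm i j h => simpa only [map_mul, FreeAlgebra.lift_ι_apply] using hc i j h
    | braid i j h => simpa only [map_mul, FreeAlgebra.lift_ι_apply] using hb i j h)
    (FreeAlgebra.ι F i)
  rw [FreeAlgebra.lift_ι_apply] at h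
  exact h

variable (F n q) in
/-- The sign character, `T_i ↦ -1`. -/
noncomputable def signChar : Hecke F n q →ₐ[F] F :=
  Hecke.lift (fun _ => -1) (fun _ => by simp) (fun _ _ _ => rfl) (fun _ _ _ => rfl)

@[simp] theorem signChar_gen (i : Fin (n - 1)) : signChar F n q (gen F n q i) = -1 :=
  Hecke.lift_gen _ _ _ _ i

theorem signChar_basisT (w : Equiv.Perm (Fin n)) :
    signChar F n q (basisT F q w) = ((Equiv.Perm.sign w : ℤ) : F) := by
  have h : ∀ l : List (Fin (n - 1)), signChar F n q ((l.map (gen F n q)).prod) =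
      ((Equiv.Perm.sign (l.map (simpleTransposition n)).prod : ℤ) : F) := by
    intro l
    induction l with
    | nil => simp
    | cons i l ih =>
      have : Equiv.Perm.sign (simpleTransposition n i) = -1 :=
        Equiv.Perm.sign_swap (lo_ne_hi i)
      simp [ih, this]
  rw [basisT, h, (isReducedWord_reducedWord w).1]

theorem basisT_simpleTransposition (i : Fin (n - 1)) :
    basisT F q (simpleTransposition n i) = gen F n q i := by
  simp [basisT, reducedWord_simpleTransposition]

theorem basisT_one : basisT F q (1 : Equiv.Perm (Fin n)) = 1 := by
  simp [basisT, reducedWord_one]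

theorem gen_mem_parabolicSubalgebra {ν : Composition n} {i : Fin (n - 1)}
    (h : ν.index (lo i) = ν.index (hi i)) : gen F n q i ∈ parabolicSubalgebra F q ν :=
  Algebra.subset_adjoin ⟨_, simpleTransposition_mem_parabolic h,
    (basisT_simpleTransposition i).symm⟩

end Basic

/-! ### The Specht module of the partition `(1^n)` -/

section SpechtOnes

variable {F : Type u} [Field F] {n : ℕ} {q : F}

/-- A part of size at least 2 yields a transposition in `S_ν`; multiplication by it pairs terms of
opposite sign. The pairwise cancellation is valid in characteristic 2 as well. -/
theorem signChar_mElt {ν : Composition n} (hν : ν ≠ Composition.ones n) :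
    signChar F n q (mElt F q ν) = 0 := by
  classical
  obtain ⟨b, hb, hb1⟩ := Composition.ne_ones_iff.1 hν
  obtain ⟨c, hc, rfl⟩ := List.getElem_of_mem hb
  let c' : Fin ν.length := ⟨c, hc⟩
  let x : Fin n := ν.embedding c' ⟨0, by change 0 < ν.blocks[c]; omega⟩
  let y : Fin n := ν.embedding c' ⟨1, hb1⟩
  have hxy : x ≠ y := fun h =>
    zero_ne_one (congrArg Fin.val ((ν.embedding c').injective h))
  have hs : Equiv.swap x y ∈ parabolic ν := fun a => by
    have hx : ν.index x = c' := ν.index_embedding _ _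
    have hy : ν.index y = c' := ν.index_embedding _ _
    rw [Equiv.swap_apply_def]
    split_ifs with h1 h2
    · rw [h1, hx, hy]
    · rw [h2, hx, hy]
    · rfl
  rw [mElt, map_sum]
  refine Finset.sum_involution (fun w _ => ⟨Equiv.swap x y, hs⟩ * w) ?_ ?_ ?_ ?_
  · intro w _
    simp [signChar_basisT, Equiv.Perm.sign_swap hxy]
  · intro w _ _ h
    have h1 : Equiv.swap x y = 1 := congrArg Subtype.val (mul_eq_right.1 h)
    exact hxy (Equiv.swap_eq_one_iff.1 h1)
  · intro w _; exact Finset.mem_univ _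
  · intro w _
    ext1
    simp [← mul_assoc]

theorem signChar_of_mem_dominatingIdeal {x : Hecke F n q}
    (hx : x ∈ dominatingIdeal F q (Composition.ones n)) : signChar F n q x = 0 := by
  induction hx using Submodule.span_induction with
  | mem x h =>
    obtain ⟨ν, -, hν, h, rfl⟩ := h
    rw [map_mul, signChar_mElt hν.1, mul_zero]
  | zero => exact map_zero _
  | add x y _ _ hx hy => rw [map_add, hx, hy, add_zero]
  | smul a x _ hx =>
    rw [← op_unop a, op_smul_eq_mul, map_mul, hx, zero_mul]

/-- The span was taken only over the right action; its generators `h * m_ν` make it closed on the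
left too, so it is a two-sided ideal. -/
theorem mul_mem_dominatingIdeal {μ : Composition n} (a : Hecke F n q) {x : Hecke F n q}
    (hx : x ∈ dominatingIdeal F q μ) : a * x ∈ dominatingIdeal F q μ := by
  induction hx using Submodule.span_induction with
  | mem x h =>
    obtain ⟨ν, h1, h2, h, rfl⟩ := h
    exact Submodule.subset_span ⟨ν, h1, h2, a * h, (mul_assoc _ _ _).symm⟩
  | zero => rw [mul_zero]; exact Submodule.zero_mem _
  | add x y _ _ hx hy => rw [mul_add]; exact Submodule.add_mem _ hx hy
  | smul b x _ hx =>
    rw [mul_smul_comm]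
    exact Submodule.smul_mem _ _ hx

theorem mem_dominatingIdeal_mul {μ : Composition n} (a : Hecke F n q) {x : Hecke F n q}
    (hx : x ∈ dominatingIdeal F q μ) : x * a ∈ dominatingIdeal F q μ :=
  Submodule.smul_mem _ (op a) hx

/-- The partition `(2, 1^{n-2})`. -/
def twoOnes (h : 2 ≤ n) : Composition n where
  blocks := 2 :: List.replicate (n - 2) 1
  blocks_pos := fun {i} hi => by
    rcases List.mem_cons.1 hi with rfl | hi
    · norm_num
    · rw [List.eq_of_mem_replicate hi]; exact Nat.one_pos
  blocks_sum := by simp; omega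

theorem strictlyDominates_twoOnes (h : 2 ≤ n) :
    StrictlyDominates (twoOnes h) (Composition.ones n) := by
  refine ⟨fun h' => ?_, fun k => ?_⟩
  · have : 2 ∈ (Composition.ones n).blocks := by rw [← h']; simp [twoOnes]
    rw [Composition.ones_blocks] at this
    simp at this
  · rw [Composition.ones_blocks]
    cases k with
    | zero => simp
    | succ k => simp [twoOnes]; omega

theorem isPartition_twoOnes (h : 2 ≤ n) : IsPartition (twoOnes h) := by
  refine List.pairwise_cons.2 ⟨fun a ha => ?_, List.pairwise_replicate.2 (Or.inr le_rfl)⟩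
  rw [List.eq_of_mem_replicate ha]; norm_num

theorem eq_zero_of_index_twoOnes (h : 2 ≤ n) {i : Fin (n - 1)}
    (hi' : (twoOnes h).index (lo i) = (twoOnes h).index (hi i)) : (i : ℕ) = 0 := by
  have h1 := (twoOnes h).sizeUpTo_index_le (lo i)
  have h2 := (twoOnes h).lt_sizeUpTo_index_succ (hi i)
  rw [← hi'] at h2
  generalize (twoOnes h).index (lo i) = c at h1 h2
  obtain ⟨c, hc⟩ := c
  have h3 : (i : ℕ) + 1 < (twoOnes h).sizeUpTo c + (twoOnes h).blocks[c] := by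
    rw [← Composition.sizeUpTo_succ _ hc]; exact h2
  have h4 : (twoOnes h).sizeUpTo c ≤ i := h1
  cases c with
  | zero =>
    have : (twoOnes h).blocks[0] = 2 := rfl
    have := (twoOnes h).sizeUpTo_zero
    omega
  | succ c =>
    have : (twoOnes h).blocks[c + 1] = 1 := by simp [twoOnes]
    omega

theorem index_twoOnes (h : 2 ≤ n) {i : Fin (n - 1)} (hi' : (i : ℕ) = 0) :
    (twoOnes h).index (lo i) = (twoOnes h).index (hi i) := by
  have h1 : ∀ a : Fin n, (a : ℕ) < 2 → ((twoOnes h).index a : ℕ) = 0 := by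
    intro a ha
    by_contra hc
    have h2 := (twoOnes h).sizeUpTo_index_le a
    have h3 := (twoOnes h).monotone_sizeUpTo (Nat.one_le_iff_ne_zero.2 hc)
    have h4 : (twoOnes h).sizeUpTo 1 = 2 := by simp [Composition.sizeUpTo, twoOnes]
    omega
  apply Fin.ext
  rw [h1 _ (by simp [lo, hi']), h1 _ (by simp [hi, hi'])]

/-- The parabolic subgroup is `{1, s}`: a reduced word in it can only use the letter `i`, and two
equal adjacent letters would cancel. -/
theorem mElt_twoOnes (h : 2 ≤ n) {i : Fin (n - 1)} (hi' : (i : ℕ) = 0) :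
    mElt F q (twoOnes h) = gen F n q i + 1 := by
  classical
  have hmem := simpleTransposition_mem_parabolic (index_twoOnes h hi')
  have huniv : (Finset.univ : Finset (parabolic (twoOnes h))) =
      {⟨simpleTransposition n i, hmem⟩, 1} := by
    ext ⟨w, hw⟩
    simp only [Finset.mem_univ, Finset.mem_insert, Finset.mem_singleton, true_iff,
      Subtype.ext_iff, OneMemClass.coe_one]
    obtain ⟨l, hl⟩ := exists_isReducedWord w
    have hl0 : ∀ j ∈ l, j = i := fun j hj =>
      Fin.ext ((eq_zero_of_index_twoOnes h (hl.index_eq hw j hj)).trans hi'.symm)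
    have h1 := hl.1
    match l with
    | [] => exact Or.inr h1.symm
    | [j] =>
      rw [hl0 j (by simp)] at h1
      exact Or.inl (by simpa using h1.symm)
    | j :: k :: l =>
      rw [hl0 j (by simp), hl0 k (by simp)] at h1
      have := hl.2 l (by
        rw [← h1, List.map_cons, List.map_cons, List.prod_cons, List.prod_cons, ← mul_assoc,
          simpleTransposition_mul_self, one_mul])
      simp at this
  unfold mElt
  rw [show @Finset.univ (parabolic (twoOnes h)) _ = _ from huniv, Finset.sum_pair]
  · simp [basisT_simpleTransposition, basisT_one]
  · intro h'
    exact simpleTransposition_ne_one i (congrArg Subtype.val h')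

/-- The case of the first generator is `m_ν` for `ν = (2, 1^{n-2})`; the braid relation carries
membership from each generator to the next, at the price of a factor `q`. -/
theorem gen_add_one_mem (hq : q ≠ 0) (i : Fin (n - 1)) :
    gen F n q i + 1 ∈ dominatingIdeal F q (Composition.ones n) := by
  obtain ⟨k, hk⟩ := i
  induction k with
  | zero =>
    have h : 2 ≤ n := by omega
    rw [← mElt_twoOnes h rfl, ← one_mul (mElt F q (twoOnes h))]
    exact Submodule.subset_span ⟨_, isPartition_twoOnes h, strictlyDominates_twoOnes h, 1, rfl⟩
  | succ k ih =>
    set a := gen F n q ⟨k, by omega⟩ with ha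
    set b := gen F n q ⟨k + 1, hk⟩ with hb
    have hI := ih (by omega)
    have hbr : a * b * a = b * a * b := gen_braid rfl
    have hbb : b * b = q • 1 + (q - 1) • b := gen_mul_gen _
    -- The braid relation kills `b a b - a b a`, and what is left, `b² + b`, equals `q (b + 1)` by
    -- the quadratic relation.
    have key : q • (b + 1) = b * ((a + 1) * b) - (a + 1) * (b * a) + b * (a + 1) := by
      have : b * ((a + 1) * b) - (a + 1) * (b * a) + b * (a + 1) =
          b * a * b - a * b * a + b * b + b := by noncomm_ring
      rw [this, hbr, hbb, smul_add, sub_smul, one_smul]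
      abel
    have hmem : q • (b + 1) ∈ dominatingIdeal F q (Composition.ones n) := by
      rw [key]
      exact Submodule.add_mem _ (Submodule.sub_mem _
        (mul_mem_dominatingIdeal _ (mem_dominatingIdeal_mul _ hI))
        (mem_dominatingIdeal_mul _ hI)) (mul_mem_dominatingIdeal _ hI)
    have := mul_mem_dominatingIdeal (algebraMap F _ q⁻¹) hmem
    rwa [← Algebra.smul_def, smul_smul, inv_mul_cancel₀ hq, one_smul] at this

/-- With `signChar_of_mem_dominatingIdeal` this says that the ideal is the kernel of the sign
character, so the quotient is one-dimensional. -/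
theorem sub_signChar_mem (hq : q ≠ 0) (h : Hecke F n q) :
    h - algebraMap F _ (signChar F n q h) ∈ dominatingIdeal F q (Composition.ones n) := by
  induction h using Hecke.induction with
  | algebraMap c => simp
  | gen i => simpa using gen_add_one_mem hq i
  | mul a b ha hb =>
    have : a * b - algebraMap F _ (signChar F n q (a * b)) =
        a * (b - algebraMap F _ (signChar F n q b)) +
          (a - algebraMap F _ (signChar F n q a)) * algebraMap F _ (signChar F n q b) := by
      rw [map_mul, map_mul]; noncomm_ring
    rw [this]
    exact Submodule.add_mem _ (mul_mem_dominatingIdeal _ hb) (mem_dominatingIdeal_mul _ ha)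
  | add a b ha hb =>
    have : a + b - algebraMap F _ (signChar F n q (a + b)) =
        (a - algebraMap F _ (signChar F n q a)) + (b - algebraMap F _ (signChar F n q b)) := by
      rw [map_add, map_add]; abel
    rw [this]
    exact Submodule.add_mem _ ha hb

variable (F n q) in
/-- The canonical generator of the Specht module of `(1^n)`. -/
noncomputable def spechtGen : Specht F q (Composition.ones n) :=
  ⟨_, Submodule.mem_span_singleton_self _⟩

theorem mElt_ones : mElt F q (Composition.ones n) = 1 := by
  classical
  have huniv : (Finset.univ : Finset (parabolic (Composition.ones n))) = {1} := by
    ext ⟨w, hw⟩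
    simp only [Finset.mem_univ, Finset.mem_singleton, true_iff, Subtype.ext_iff,
      OneMemClass.coe_one]
    ext a
    have h1 : ∀ a : Fin n, ((Composition.ones n).index a : ℕ) = a := fun a => by
      have h2 := (Composition.ones n).sizeUpTo_index_le a
      have h3 : (a : ℕ) < (Composition.ones n).sizeUpTo ((Composition.ones n).index a + 1) :=
        (Composition.ones n).lt_sizeUpTo_index_succ a
      rw [Composition.ones_sizeUpTo] at h2 h3
      omega
    rw [← h1, hw a, h1]
    rfl
  unfold mElt
  rw [show @Finset.univ (parabolic (Composition.ones n)) _ = _ from huniv, Finset.sum_singleton]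
  exact basisT_one

theorem spechtGen_ne_zero : spechtGen F n q ≠ 0 := by
  intro h
  have h1 := congrArg Subtype.val h
  have h2 := (Submodule.Quotient.mk_eq_zero _).1 h1
  rw [mElt_ones] at h2
  simpa using signChar_of_mem_dominatingIdeal h2

theorem op_smul_spechtGen (hq : q ≠ 0) (h : Hecke F n q) :
    op h • spechtGen F n q = signChar F n q h • spechtGen F n q := by
  apply Subtype.ext
  change (Submodule.Quotient.mk (op h • mElt F q (Composition.ones n)) : _ ⧸ dominatingIdeal F q _)
    = Submodule.Quotient.mk (signChar F n q h • mElt F q (Composition.ones n))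
  rw [Submodule.Quotient.eq, mElt_ones, op_smul_eq_mul, one_mul, ← Algebra.algebraMap_eq_smul_one]
  exact sub_signChar_mem hq h

theorem exists_smul_spechtGen (hq : q ≠ 0) (x : Specht F q (Composition.ones n)) :
    ∃ c : F, c • spechtGen F n q = x := by
  obtain ⟨x, hx⟩ := x
  obtain ⟨a, rfl⟩ := Submodule.mem_span_singleton.1 hx
  refine ⟨signChar F n q a.unop, ?_⟩
  rw [← op_smul_spechtGen hq]
  rfl

theorem op_smul_specht (hq : q ≠ 0) (h : Hecke F n q) (x : Specht F q (Composition.ones n)) :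
    op h • x = signChar F n q h • x := by
  obtain ⟨c, rfl⟩ := exists_smul_spechtGen hq x
  rw [smul_comm, op_smul_spechtGen hq, smul_comm]

theorem finrank_specht (hq : q ≠ 0) :
    Module.finrank F (Specht F q (Composition.ones n)) = 1 :=
  finrank_eq_one _ spechtGen_ne_zero (exists_smul_spechtGen hq)

end SpechtOnes

/-! ### Basis elements indexed by words -/

section WordT

variable (F : Type u) [Field F] {n : ℕ} (q : F) {α : Type*} [LinearOrder α]

open Classical in
/-- The basis element of the shortest permutation that sorts the word `f`. -/
noncomputable def wordT (f : Fin n → α) : Hecke F n q :=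
  if h : ∃ i, f (hi i) < f (lo i) then wordT (exch f h.choose) * gen F n q h.choose else 1
termination_by inversionCount f
decreasing_by
  have := inversionCount_exch' h.choose_spec
  omega

variable {F q}

theorem wordT_of_monotone {f : Fin n → α} (hf : Monotone f) : wordT F q f = 1 := by
  rw [wordT, dif_neg]
  rintro ⟨i, h⟩
  exact absurd (hf (lo_lt_hi i).le) (not_le.2 h)

/-- The defining recursion of `wordT` holds for every descent. -/
theorem wordT_exch {f : Fin n → α} {i : Fin (n - 1)} (h : f (hi i) < f (lo i)) :
    wordT F q f = wordT F q (exch f i) * gen F n q i := by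
  induction hk : inversionCount f using Nat.strong_induction_on generalizing f i with
  | _ k ih =>
    subst hk
    -- Independence of the chosen descent, as in Matsumoto's theorem. Two adjacent descents mean
    -- three decreasing letters; both routes reach the word with these letters in increasing order,
    -- by `T_i T_j T_i` and `T_j T_i T_j`. Distant descents commute.
    have braid : ∀ i j : Fin (n - 1), (j : ℕ) = i + 1 → f (hi i) < f (lo i) →
        f (hi j) < f (lo j) → wordT F q (exch f i) * gen F n q i =
          wordT F q (exch f j) * gen F n q j := by
      intro i j hij h1 h2
      have e1 := inversionCount_exch' h1
      have e2 := inversionCount_exch' h2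
      rw [lo_of_succ hij] at h2
      have d1 : exch f i (hi j) < exch f i (lo j) := by
        rw [exch_hi_succ f hij, lo_of_succ hij, exch_hi]; exact h2.trans h1
      have d2 : exch f j (hi i) < exch f j (lo i) := by
        rw [exch_hi_pred f hij, exch_lo_pred f hij]; exact h2.trans h1
      have e3 := inversionCount_exch' d1
      have e4 := inversionCount_exch' d2
      have d3 : exch (exch f i) j (hi i) < exch (exch f i) j (lo i) := by
        rw [exch_hi_pred _ hij, exch_lo_pred _ hij, exch_hi_succ f hij, exch_lo]; exact h2
      have d4 : exch (exch f j) i (hi j) < exch (exch f j) i (lo j) := by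
        rw [exch_hi_succ _ hij, exch_hi, lo_of_succ hij, exch_hi, exch_lo_pred f hij]
        exact h1
      rw [ih _ (by omega) d1 rfl, ih _ (by omega) d2 rfl, ih _ (by omega) d3 rfl,
        ih _ (by omega) d4 rfl, exch_braid f hij]
      simp only [mul_assoc]
      rw [← mul_assoc (gen F n q i), gen_braid hij, mul_assoc]
    have far : ∀ i j : Fin (n - 1), ((i : ℕ) + 1 < j ∨ (j : ℕ) + 1 < i) → f (hi i) < f (lo i) →
        f (hi j) < f (lo j) → wordT F q (exch f j) * gen F n q j =
          wordT F q (exch f i) * gen F n q i := by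
      intro i j hij h1 h2
      have e1 := inversionCount_exch' h1
      have e2 := inversionCount_exch' h2
      have d1 : exch f i (hi j) < exch f i (lo j) := by
        rwa [exch_hi_of_far f hij, exch_lo_of_far f hij]
      have d2 : exch f j (hi i) < exch f j (lo i) := by
        rwa [exch_hi_of_far f hij.symm, exch_lo_of_far f hij.symm]
      rw [ih _ (by omega) d1 rfl, ih _ (by omega) d2 rfl, exch_comm f hij, mul_assoc, mul_assoc,
        gen_comm hij]
    have hex : ∃ i, f (hi i) < f (lo i) := ⟨i, h⟩
    rw [wordT, dif_pos hex]
    have hj := hex.choose_spec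
    generalize hex.choose = j at hj
    rcases lt_trichotomy ((i : ℕ) + 1) j with hij | hij | hij
    · exact far i j (Or.inl hij) h hj
    · exact (braid i j hij.symm h hj).symm
    rcases lt_trichotomy ((j : ℕ) + 1) i with hji | hji | hji
    · exact far i j (Or.inr hji) h hj
    · exact braid j i hji.symm hj h
    · rw [Fin.ext (show (i : ℕ) = j by omega)]

theorem signChar_wordT (f : Fin n → α) :
    signChar F n q (wordT F q f) = (-1) ^ inversionCount f := by
  induction hk : inversionCount f using Nat.strong_induction_on generalizing f with
  | _ k ih =>
    subst hk
    by_cases h : ∃ i, f (hi i) < f (lo i)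
    · obtain ⟨i, h⟩ := h
      have e := inversionCount_exch' h
      rw [wordT_exch h, map_mul, signChar_gen, ih _ (by omega) _ rfl, e, pow_succ]
    · push Not at h
      have hm := monotone_of_lo_le_hi h
      rw [wordT_of_monotone hm, inversionCount_of_monotone hm, map_one, pow_zero]

variable {V : Type*} [AddCommGroup V] [Module (Hecke F n q)ᵐᵒᵖ V]

/-- If `v` is a sign vector for the parabolic subalgebra that belongs to the level sets of the
sorted word `f₀`, then the translate of `v` by `wordT f` is a sign vector for the level sets
of `f`. -/
theorem op_wordT_mul_gen_smul {f₀ : Fin n → α} (hf₀ : Monotone f₀) {v : V}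
    (hv : ∀ i, f₀ (lo i) = f₀ (hi i) → op (gen F n q i) • v = -v)
    {f : Fin n → α} (hf : ∃ σ : Equiv.Perm (Fin n), f = f₀ ∘ σ) {i : Fin (n - 1)}
    (h : f (lo i) = f (hi i)) :
    op (wordT F q f * gen F n q i) • v = -(op (wordT F q f) • v) := by
  induction hk : inversionCount f using Nat.strong_induction_on generalizing f i with
  | _ k ih =>
    subst hk
    by_cases hd : ∃ j, f (hi j) < f (lo j)
    swap
    · push Not at hd
      have hm := monotone_of_lo_le_hi hd
      have := eq_of_monotone_of_perm hm hf₀ hf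
      subst this
      rw [wordT_of_monotone hm, one_mul, op_one, one_smul, hv i h]
    obtain ⟨j, hj⟩ := hd
    have e1 := inversionCount_exch' hj
    have far : ((i : ℕ) + 1 < j ∨ (j : ℕ) + 1 < i) →
        op (wordT F q f * gen F n q i) • v = -(op (wordT F q f) • v) := by
      intro hij
      have h' : exch f j (lo i) = exch f j (hi i) := by
        rwa [exch_hi_of_far f hij.symm, exch_lo_of_far f hij.symm]
      rw [wordT_exch hj, mul_assoc, ← gen_comm hij, ← mul_assoc, op_mul, mul_smul,
        ih _ (by omega) (exch_perm hf j) h' rfl, op_mul, mul_smul, smul_neg]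
    -- Adjacent indices, with equal letters at `i` and a descent at `j`. After the exchanges at `j`
    -- and `i` the equal letters stand at `j`. With `T_d = T_{d'} T_i T_j` the braid relation gives
    -- `T_d T_i = T_{d'} T_j T_i T_j`, and induction applies to `T_{d'} T_j`.
    have close : gen F n q i * gen F n q j * gen F n q i =
          gen F n q j * gen F n q i * gen F n q j →
        exch f j (hi i) < exch f j (lo i) →
        exch (exch f j) i (lo j) = exch (exch f j) i (hi j) →
        op (wordT F q f * gen F n q i) • v = -(op (wordT F q f) • v) := by
      intro hb d1 h'
      have e2 := inversionCount_exch' d1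
      have := ih _ (by omega) (exch_perm (exch_perm hf j) i) h' rfl
      rw [wordT_exch hj, wordT_exch d1, mul_assoc, mul_assoc, ← mul_assoc (gen F n q i), hb,
        mul_assoc, ← mul_assoc, op_mul, mul_smul, this, mul_assoc, op_mul _ (_ * _), mul_smul,
        smul_neg]
    rcases lt_trichotomy ((i : ℕ) + 1) j with hij | hij | hij
    · exact far (Or.inl hij)
    · have hij := hij.symm
      rw [lo_of_succ hij] at hj
      refine close (gen_braid hij) ?_ ?_
      · rw [exch_hi_pred f hij, exch_lo_pred f hij, h]; exact hj
      · rw [lo_of_succ hij, exch_hi, exch_hi_succ _ hij, exch_lo_pred f hij, exch_hi,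
          lo_of_succ hij, h]
    rcases lt_trichotomy ((j : ℕ) + 1) i with hji | hji | hji
    · exact far (Or.inr hji)
    · have hji := hji.symm
      rw [lo_of_succ hji] at h
      refine close (gen_braid hji).symm ?_ ?_
      · rw [exch_hi_succ f hji, lo_of_succ hji, exch_hi, ← h]; exact hj
      · rw [exch_lo_pred _ hji, exch_hi_pred _ hji, exch_hi_succ f hji, exch_lo, h]
    · rw [Fin.ext (show (j : ℕ) = i by omega), h] at hj
      exact absurd hj (lt_irrefl _)

end WordT

/-! ### The relative trace on sign vectors -/

section Trace

variable (F : Type u) [Field F] {n : ℕ} (q : F) {k : ℕ}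

open Classical in
/-- The rearrangements of a word. -/
noncomputable def rearrangements (f₀ : Fin n → Fin k) : Finset (Fin n → Fin k) :=
  Finset.univ.filter fun f => ∃ σ : Equiv.Perm (Fin n), f = f₀ ∘ σ

theorem mem_rearrangements {f₀ f : Fin n → Fin k} :
    f ∈ rearrangements f₀ ↔ ∃ σ : Equiv.Perm (Fin n), f = f₀ ∘ σ := by
  simp [rearrangements]

theorem exch_mem_rearrangements {f₀ f : Fin n → Fin k} (h : f ∈ rearrangements f₀)
    (i : Fin (n - 1)) : exch f i ∈ rearrangements f₀ :=
  mem_rearrangements.2 (exch_perm (mem_rearrangements.1 h) i)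

variable {F} in
/-- The generating function, at `q⁻¹`, of the inversions of the rearrangements of a word. -/
noncomputable def inversionSum (f₀ : Fin n → Fin k) : F :=
  ∑ f ∈ rearrangements f₀, q⁻¹ ^ inversionCount f

/-- The relative trace element that belongs to a sorted word. -/
noncomputable def traceElt (f₀ : Fin n → Fin k) : Hecke F n q :=
  ∑ f ∈ rearrangements f₀, (-q⁻¹) ^ inversionCount f • wordT F q f

variable {F q}

theorem signChar_traceElt (f₀ : Fin n → Fin k) :
    signChar F n q (traceElt F q f₀) = inversionSum q f₀ := by
  rw [traceElt, map_sum, inversionSum]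
  refine Finset.sum_congr rfl fun f _ => ?_
  rw [map_smul, signChar_wordT, smul_eq_mul, ← mul_pow]
  simp

variable {V : Type*} [AddCommGroup V] [Module (Hecke F n q)ᵐᵒᵖ V]

/-- After multiplication by `T_i + 1`, the terms of `f` and `exch f i` cancel: for an ascent they
involve `T_d` and `T_d T_i`, and the weight ratio `-q⁻¹` is the one for which the quadratic relation
gives zero. A word with equal letters at `i` contributes zero by `op_wordT_mul_gen_smul`. -/
theorem op_gen_smul_traceElt (hq : q ≠ 0) {f₀ : Fin n → Fin k} (hf₀ : Monotone f₀) {v : V}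
    (hv : ∀ i, f₀ (lo i) = f₀ (hi i) → op (gen F n q i) • v = -v) (i : Fin (n - 1)) :
    op (gen F n q i) • op (traceElt F q f₀) • v = -(op (traceElt F q f₀) • v) := by
  rw [← add_eq_zero_iff_eq_neg, smul_smul, ← op_mul, ← add_smul, ← op_add, traceElt,
    Finset.sum_mul, ← Finset.sum_add_distrib, Finset.op_sum, Finset.sum_smul]
  set t : (Fin n → Fin k) → Hecke F n q := fun f =>
    (-q⁻¹) ^ inversionCount f • wordT F q f * gen F n q i +
      (-q⁻¹) ^ inversionCount f • wordT F q f with ht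
  have asc : ∀ f : Fin n → Fin k, f (lo i) < f (hi i) → t f + t (exch f i) = 0 := by
    intro f h
    have h' : exch f i (hi i) < exch f i (lo i) := by simpa using h
    have hw := wordT_exch (F := F) (q := q) h'
    rw [exch_exch] at hw
    simp only [ht, inversionCount_exch h, hw, smul_mul_assoc]
    rw [mul_assoc, gen_mul_gen, mul_add, mul_smul_comm, mul_smul_comm, mul_one]
    generalize inversionCount f = m
    rw [pow_succ]
    generalize (-q⁻¹) ^ m = c
    match_scalars <;> field_simp <;> ring
  have level : ∀ f ∈ rearrangements f₀, f (lo i) = f (hi i) → op (t f) • v = 0 := by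
    intro f hf h
    have h1 := op_wordT_mul_gen_smul hf₀ hv (mem_rearrangements.1 hf) h
    have h2 : t f = (wordT F q f * gen F n q i + wordT F q f) *
        algebraMap F _ ((-q⁻¹) ^ inversionCount f) := by
      rw [← Algebra.commutes, ← Algebra.smul_def, smul_add]
      simp only [ht, smul_mul_assoc]
    rw [h2, op_mul, mul_smul, op_add, add_smul, h1, neg_add_cancel, smul_zero]
  refine Finset.sum_involution (fun f _ => exch f i) ?_ ?_ ?_ ?_
  · intro f hf
    change op (t f) • v + op (t (exch f i)) • v = 0
    rcases lt_trichotomy (f (lo i)) (f (hi i)) with h | h | h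
    · rw [← add_smul, ← op_add, asc f h, op_zero, zero_smul]
    · rw [exch_of_eq h, level f hf h, add_zero]
    · have := asc (exch f i) (by simpa using h)
      rw [exch_exch, add_comm] at this
      rw [← add_smul, ← op_add, this, op_zero, zero_smul]
  · intro f hf h0 heq
    refine h0 (level f hf ?_)
    by_contra h
    exact exch_ne h heq
  · intro f hf; exact exch_mem_rearrangements hf i
  · intro f _; exact exch_exch f i

end Trace

/-! ### The relative projectivity criterion: sufficiency -/

section Sufficiency

variable {F : Type u} [Field F] {n : ℕ} {q : F}

/-- The test modules of relative projectivity carry no `F`-structure of their own; scalars act as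
central elements of the algebra. -/
theorem op_smul_algebraMap_comm {V : Type*} [AddCommGroup V] [Module (Hecke F n q)ᵐᵒᵖ V]
    (h : Hecke F n q) (c : F) (v : V) :
    op h • op (algebraMap F (Hecke F n q) c) • v =
      op (algebraMap F (Hecke F n q) c) • op h • v := by
  rw [smul_smul, smul_smul, ← op_mul, ← op_mul, Algebra.commutes]

/-- A module on which the Hecke algebra acts through the sign character is relatively projective
for the parabolic subalgebra of `ν` as soon as the inversion sum of `ν` does not vanish. -/
theorem isRelativelyProjective_of_inversionSum_ne_zero (hq : q ≠ 0) {M : Type u}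
    [AddCommGroup M] [Module (Hecke F n q)ᵐᵒᵖ M]
    (hM : ∀ (h : Hecke F n q) (x : M),
      op h • x = op (algebraMap F (Hecke F n q) (signChar F n q h)) • x)
    {ν : Composition n} (hν : inversionSum q ν.index ≠ 0) :
    IsRelativelyProjective (parabolicSubalgebra F q ν) M := by
  intro V W _ _ _ _ β α _ ⟨γ, hγ⟩
  set X := traceElt F q ν.index with hX
  set c := signChar F n q X with hc
  have hc0 : c ≠ 0 := by rw [hc, hX, signChar_traceElt]; exact hν
  have hγs : ∀ a (ha : a ∈ parabolicSubalgebra F q ν) (x : M), γ (op a • x) = op a • γ x :=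
    fun a ha x => γ.map_smul (⟨op a, ha⟩ : (parabolicSubalgebra F q ν).op) x
  have hγc : ∀ (a : F) (x : M), γ (op (algebraMap F (Hecke F n q) a) • x) =
      op (algebraMap F (Hecke F n q) a) • γ x :=
    fun a => hγs _ (Subalgebra.algebraMap_mem _ a)
  have hneg : ∀ (i : Fin (n - 1)) (x : M), op (gen F n q i) • x = -x := fun i x => by
    rw [hM, signChar_gen, map_neg, map_one, op_neg, op_one, neg_smul, one_smul]
  -- Since `γ` is `H_ν`-linear, `γ x` is a sign vector for `H_ν`, and the trace element makes it one
  -- for `H_n`. The required lift is this vector divided by `c`.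
  have hsign : ∀ (h : Hecke F n q) (x : M), op h • op X • γ x =
      op (algebraMap F (Hecke F n q) (signChar F n q h)) • op X • γ x := by
    intro h x
    induction h using Hecke.induction with
    | algebraMap a => rw [AlgHom.commutes]; rfl
    | gen i =>
      rw [signChar_gen, map_neg, map_one, op_neg, op_one, neg_smul, one_smul]
      refine op_gen_smul_traceElt hq (index_monotone ν) (fun j hj => ?_) i
      rw [← hγs _ (gen_mem_parabolicSubalgebra hj), hneg, map_neg]
    | mul a b ha hb =>
      rw [op_mul, mul_smul, ha, op_smul_algebraMap_comm, hb,
        smul_smul, ← op_mul, ← map_mul, map_mul (signChar F n q), mul_comm]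
    | add a b ha hb =>
      rw [op_add, add_smul, ha, hb, map_add, map_add, op_add, add_smul]
  refine ⟨{ toFun := fun x => op (algebraMap F (Hecke F n q) c⁻¹) • op X • γ x
            map_add' := fun x y => by simp only [map_add, smul_add]
            map_smul' := fun a x => ?_ }, fun x => ?_⟩
  · obtain ⟨a, rfl⟩ := op_surjective a
    rw [RingHom.id_apply, hM, hγc, op_smul_algebraMap_comm, op_smul_algebraMap_comm a, hsign a]
  · change β (op (algebraMap F (Hecke F n q) c⁻¹) • op X • γ x) = α x
    rw [map_smul, map_smul, hγ, ← map_smul, ← map_smul, hM X, smul_smul, ← op_mul, ← map_mul,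
      mul_inv_cancel₀ hc0, map_one, op_one, one_smul]

end Sufficiency

/-! ### The sign module and the module of words -/

section SignModule

variable (F : Type u) [Field F] (n : ℕ) (q : F)

/-- The sign module. -/
@[nolint unusedArguments]
def SignModule (F : Type u) [Field F] (_ : ℕ) (_ : F) : Type u := F

noncomputable instance : AddCommGroup (SignModule F n q) := inferInstanceAs (AddCommGroup F)

noncomputable instance : Module (Hecke F n q)ᵐᵒᵖ (SignModule F n q) :=
  Module.compHom F ((signChar F n q).toRingHom.fromOpposite fun _ _ => mul_comm _ _)

variable {F n q}

theorem op_smul_signModule (h : Hecke F n q) (x : SignModule F n q) :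
    op h • x = (signChar F n q h * (show F from x) : F) := rfl

end SignModule

section WordModule

variable (F : Type u) [Field F] (n k : ℕ) (q : F)

/-- The module of functions on words. -/
@[nolint unusedArguments]
def WordModule (F : Type u) [Field F] (n k : ℕ) (_ : F) : Type u := (Fin n → Fin k) → F

noncomputable instance : AddCommGroup (WordModule F n k q) :=
  inferInstanceAs (AddCommGroup ((Fin n → Fin k) → F))

noncomputable instance : Module F (WordModule F n k q) :=
  inferInstanceAs (Module F ((Fin n → Fin k) → F))

/-- The action of the generator with index `i` on functions on words. -/
def wordAct (i : Fin (n - 1)) : Module.End F (WordModule F n k q) where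
  -- Coefficientwise form of `e_g T_i = -e_g`, `e_{gs}` or `q e_{gs} + (q - 1) e_g`, for equal
  -- letters, an ascent or a descent of `g` at `i`. With `e_g = v ⊗ T_d` this is the sum, over all
  -- contents of words, of the modules induced from parabolic sign modules.
  toFun φ := fun g => if g (lo i) = g (hi i) then -φ g else
    if g (lo i) < g (hi i) then q * φ (exch g i) else φ (exch g i) + (q - 1) * φ g
  map_add' φ ψ := by
    funext g
    change ite _ (-(φ g + ψ g)) (ite _ (q * (φ _ + ψ _)) (φ _ + ψ _ + (q - 1) * (φ g + ψ g))) =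
      ite _ _ _ + ite _ _ _
    split_ifs <;> ring
  map_smul' c φ := by
    funext g
    change ite _ (-(c * φ g)) (ite _ (q * (c * φ _)) (c * φ _ + (q - 1) * (c * φ g))) =
      c * ite _ _ _
    split_ifs <;> ring

variable {F n k q}

theorem wordAct_apply (i : Fin (n - 1)) (φ : WordModule F n k q) (g : Fin n → Fin k) :
    wordAct F n k q i φ g = if g (lo i) = g (hi i) then -φ g else
      if g (lo i) < g (hi i) then q * φ (exch g i) else φ (exch g i) + (q - 1) * φ g := rfl

theorem wordAct_quadratic (i : Fin (n - 1)) :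
    (wordAct F n k q i + 1) * (wordAct F n k q i - algebraMap F _ q) = 0 := by
  refine LinearMap.ext fun φ => funext fun g => ?_
  rw [Algebra.algebraMap_eq_smul_one]
  set ψ := (wordAct F n k q i - q • (1 : Module.End F (WordModule F n k q))) φ with hψ
  have hψ' : ∀ g, ψ g = wordAct F n k q i φ g - q * φ g := fun g => rfl
  change wordAct F n k q i ψ g + ψ g = 0
  rw [wordAct_apply]
  simp only [hψ', wordAct_apply, exch_exch, exch_lo, exch_hi]
  rcases lt_trichotomy (g (lo i)) (g (hi i)) with h | h | h
  · simp only [h, h.ne, h.ne', not_lt_of_gt h, if_true, if_false]; ring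
  · simp only [h, if_true]; ring
  · simp only [h, h.ne, h.ne', not_lt_of_gt h, if_true, if_false]; ring

theorem wordAct_comm {i j : Fin (n - 1)} (h : (i : ℕ) + 1 < j ∨ (j : ℕ) + 1 < i) :
    wordAct F n k q i * wordAct F n k q j = wordAct F n k q j * wordAct F n k q i := by
  refine LinearMap.ext fun φ => funext fun g => ?_
  change wordAct F n k q i (wordAct F n k q j φ) g = wordAct F n k q j (wordAct F n k q i φ) g
  simp only [wordAct_apply, exch_lo_of_far _ h, exch_hi_of_far _ h, exch_lo_of_far _ h.symm,
    exch_hi_of_far _ h.symm, exch_comm g h]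
  split_ifs <;> ring

/-- Only the relative order of three neighbouring letters matters, and the consistent orders are
checked one by one. Where two letters agree, some iterated exchanges coincide; `e1` to `e5` record
this. -/
theorem wordAct_braid {i j : Fin (n - 1)} (h : (j : ℕ) = i + 1) :
    wordAct F n k q i * wordAct F n k q j * wordAct F n k q i =
      wordAct F n k q j * wordAct F n k q i * wordAct F n k q j := by
  refine LinearMap.ext fun φ => funext fun g => ?_
  change wordAct F n k q i (wordAct F n k q j (wordAct F n k q i φ)) g =
    wordAct F n k q j (wordAct F n k q i (wordAct F n k q j φ)) g
  simp only [wordAct_apply, exch_exch, exch_lo, exch_hi, lo_of_succ h, exch_hi_succ _ h,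
    exch_lo_pred _ h, exch_hi_pred _ h, exch_braid g h]
  have e1 : g (lo i) = g (hi i) → exch g i = g := exch_of_eq
  have e2 : g (hi i) = g (hi j) → exch g j = g := fun h' => exch_of_eq (by rwa [lo_of_succ h])
  have e3 : g (lo i) = g (hi j) → exch (exch g j) i = exch g j := fun h' =>
    exch_of_eq (by rw [exch_lo_pred _ h, exch_hi_pred _ h, h'])
  have e4 : g (lo i) = g (hi j) → exch (exch g i) j = exch g i := fun h' =>
    exch_of_eq (by rw [lo_of_succ h, exch_hi, exch_hi_succ _ h, h'])
  have e5 : g (lo i) = g (hi i) → exch (exch (exch g j) i) j = exch (exch g j) i := fun h' => by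
    rw [← exch_braid g h, e1 h']
  generalize g (lo i) = a at *
  generalize g (hi i) = b at *
  generalize g (hi j) = c at *
  rcases lt_trichotomy a b with h1 | h1 | h1 <;>
  rcases lt_trichotomy b c with h2 | h2 | h2 <;>
  rcases lt_trichotomy a c with h3 | h3 | h3 <;>
  first
  | (exfalso; order)
  | (have n1 := h1.not_gt; have n2 := h2.not_gt; have n3 := h3.not_gt
     simp only [h1, h2, h3, h1.ne, h1.ne', h2.ne, h2.ne', h3.ne, h3.ne', n1, n2, n3, if_true,
       if_false] <;> ring1)
  | (subst h1; subst h2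
     simp only [e1 rfl, e2 rfl, if_true])
  | (subst h1; have n2 := h2.not_gt
     simp only [e1 rfl, e5 rfl, h2, h2.ne, h2.ne', n2, if_true, if_false]
     ring1)
  | (subst h2; have n1 := h1.not_gt
     simp only [e2 rfl, h1, h1.ne, h1.ne', n1, if_true, if_false]
     ring1)
  | (subst h3; have n1 := h1.not_gt
     simp only [e3 rfl, e4 rfl, h1, h1.ne, h1.ne', n1, if_true, if_false]
     ring1)

variable (F n k q) in
/-- The right action of the Hecke algebra on functions on words. -/
noncomputable def wordAction : Hecke F n q →ₐ[F] (Module.End F (WordModule F n k q))ᵐᵒᵖ :=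
  Hecke.lift (fun i => op (wordAct F n k q i))
    (fun i => by
      apply unop_injective
      rw [unop_mul, unop_sub, unop_add, unop_op, unop_one, unop_zero]
      exact wordAct_quadratic i)
    (fun i j h => by rw [← op_mul, ← op_mul, wordAct_comm h])
    (fun i j h => by rw [← op_mul, ← op_mul, ← op_mul, ← op_mul, ← mul_assoc, ← mul_assoc,
      wordAct_braid h])

noncomputable instance : Module (Hecke F n q)ᵐᵒᵖ (WordModule F n k q) :=
  Module.compHom (WordModule F n k q)
    ((RingEquiv.opOp (Module.End F (WordModule F n k q))).symm.toRingHom.comp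
      (RingHom.op (wordAction F n k q).toRingHom))

theorem op_smul_wordModule (h : Hecke F n q) (φ : WordModule F n k q) :
    op h • φ = (wordAction F n k q h).unop φ := rfl

theorem op_gen_smul_wordModule (i : Fin (n - 1)) (φ : WordModule F n k q) :
    op (gen F n q i) • φ = wordAct F n k q i φ := by
  rw [op_smul_wordModule, wordAction, Hecke.lift_gen, unop_op]

theorem op_algebraMap_smul_wordModule (c : F) (φ : WordModule F n k q) :
    op (algebraMap F (Hecke F n q) c) • φ = c • φ := by
  rw [op_smul_wordModule, AlgHom.commutes]
  rfl

theorem op_smul_smul_wordModule (h : Hecke F n q) (c : F) (φ : WordModule F n k q) :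
    op h • c • φ = c • op h • φ := by
  rw [op_smul_wordModule, op_smul_wordModule, map_smul]

/-- A sign vector in the module of words is determined by its value at the sorted word. -/
theorem wordModule_apply_of_sign (hq : q ≠ 0) {φ : WordModule F n k q}
    (hφ : ∀ i, wordAct F n k q i φ = -φ) {f₀ : Fin n → Fin k} (hf₀ : Monotone f₀)
    {f : Fin n → Fin k} (hf : ∃ σ : Equiv.Perm (Fin n), f = f₀ ∘ σ) :
    φ f = (-q⁻¹) ^ inversionCount f * φ f₀ := by
  induction hk : inversionCount f using Nat.strong_induction_on generalizing f with
  | _ k ih =>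
    subst hk
    by_cases h : ∃ i, f (hi i) < f (lo i)
    · obtain ⟨i, h⟩ := h
      have e := inversionCount_exch' h
      -- The word `exch f i` has an ascent at `i`, so the sign equation there reads `q * φ f = -φ
      -- (exch f i)`.
      have h1 : wordAct F n _ q i φ (exch f i) = -φ (exch f i) := congrFun (hφ i) _
      rw [wordAct_apply, exch_lo, exch_hi, if_neg h.ne, if_pos h, exch_exch,
        ih _ (by omega) (exch_perm hf i) rfl] at h1
      rw [e, pow_succ]
      field_simp at h1 ⊢
      linear_combination h1
    · push Not at h
      have hm := monotone_of_lo_le_hi h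
      have := eq_of_monotone_of_perm hm hf₀ hf
      subst this
      rw [inversionCount_of_monotone hm, pow_zero, one_mul]

/-- The alternating sum of the values of a function on the rearrangements of a word. -/
noncomputable def altSum (f₀ : Fin n → Fin k) (φ : WordModule F n k q) : F :=
  ∑ f ∈ rearrangements f₀, (-1) ^ inversionCount f * φ f

/-- `altSum` sends `e_f` to the sign of `T_d`, so it is the map that the identity of the sign module
induces. In the check the terms of `f` and `exch f i` cancel. -/
theorem altSum_wordAct (f₀ : Fin n → Fin k) (i : Fin (n - 1)) (φ : WordModule F n k q) :
    altSum f₀ (wordAct F n k q i φ) = -altSum f₀ φ := by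
  rw [← add_eq_zero_iff_eq_neg, altSum, altSum, ← Finset.sum_add_distrib]
  set t : (Fin n → Fin k) → F := fun f =>
    (-1) ^ inversionCount f * wordAct F n k q i φ f + (-1) ^ inversionCount f * φ f with ht
  have asc : ∀ f : Fin n → Fin k, f (lo i) < f (hi i) → t f + t (exch f i) = 0 := by
    intro f h
    simp only [ht, inversionCount_exch h, wordAct_apply, exch_exch, exch_lo, exch_hi, h.ne, h.ne',
      h, h.not_gt, if_true, if_false, pow_succ]
    ring
  have level : ∀ f : Fin n → Fin k, f (lo i) = f (hi i) → t f = 0 := by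
    intro f h
    simp only [ht, wordAct_apply, h, if_true]
    ring
  refine Finset.sum_involution (fun f _ => exch f i) ?_ ?_ ?_ ?_
  · intro f hf
    change t f + t (exch f i) = 0
    rcases lt_trichotomy (f (lo i)) (f (hi i)) with h | h | h
    · exact asc f h
    · rw [exch_of_eq h, level f h, add_zero]
    · have := asc (exch f i) (by simpa using h)
      rwa [exch_exch, add_comm] at this
  · intro f hf h0 heq
    refine h0 (level f ?_)
    by_contra h
    exact exch_ne h heq
  · intro f hf; exact exch_mem_rearrangements hf i
  · intro f _; exact exch_exch f i

variable (F q) in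
/-- The alternating sum as a homomorphism to the sign module. -/
noncomputable def altSumHom (f₀ : Fin n → Fin k) :
    WordModule F n k q →ₗ[(Hecke F n q)ᵐᵒᵖ] SignModule F n q where
  toFun φ := (altSum f₀ φ : F)
  map_add' φ ψ := by
    change altSum f₀ _ = (altSum f₀ φ + altSum f₀ ψ : F)
    rw [altSum, altSum, altSum, ← Finset.sum_add_distrib]
    refine Finset.sum_congr rfl fun f _ => ?_
    rw [← mul_add]; rfl
  map_smul' a φ := by
    obtain ⟨a, rfl⟩ := op_surjective a
    change (altSum f₀ (op a • φ) : F) = signChar F n q a * altSum f₀ φ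
    induction a using Hecke.induction generalizing φ with
    | algebraMap c =>
      rw [op_algebraMap_smul_wordModule, AlgHom.commutes, Algebra.algebraMap_self_apply]
      rw [altSum, altSum, Finset.mul_sum]
      refine Finset.sum_congr rfl fun f _ => ?_
      change _ * (c * φ f) = _
      ring
    | gen i =>
      rw [op_gen_smul_wordModule, altSum_wordAct, signChar_gen]
      ring
    | mul a b ha hb =>
      rw [op_mul, mul_smul, hb, ha, map_mul]
      ring
    | add a b ha hb =>
      have h1 := ha φ
      have h2 := hb φ
      have : altSum f₀ (op a • φ + op b • φ) = altSum f₀ (op a • φ) + altSum f₀ (op b • φ) := by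
        rw [altSum, altSum, altSum, ← Finset.sum_add_distrib]
        refine Finset.sum_congr rfl fun f _ => ?_
        rw [← mul_add]; rfl
      rw [op_add, add_smul, this, h1, h2, map_add]
      ring

end WordModule

/-! ### The relative projectivity criterion: necessity -/

section Necessity

variable {F : Type u} [Field F] {n k : ℕ} {q : F}

variable (F q) in
/-- The indicator function of a word. -/
noncomputable def wordDelta (f₀ : Fin n → Fin k) : WordModule F n k q :=
  (Pi.single f₀ 1 : (Fin n → Fin k) → F)

theorem wordDelta_self (f₀ : Fin n → Fin k) : wordDelta F q f₀ f₀ = 1 :=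
  Pi.single_eq_same (M := fun _ => F) f₀ 1

theorem wordDelta_of_ne {f₀ f : Fin n → Fin k} (h : f ≠ f₀) : wordDelta F q f₀ f = 0 :=
  Pi.single_eq_of_ne (M := fun _ => F) h 1

theorem wordAct_wordDelta {f₀ : Fin n → Fin k} {i : Fin (n - 1)} (h : f₀ (lo i) = f₀ (hi i)) :
    wordAct F n k q i (wordDelta F q f₀) = -wordDelta F q f₀ := by
  funext g
  change _ = -(wordDelta F q f₀ g)
  rw [wordAct_apply]
  split_ifs with h1 h2
  · rfl
  all_goals
    have h3 : g ≠ f₀ := by rintro rfl; exact h1 h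
    have h4 : exch g i ≠ f₀ := by
      rintro rfl
      rw [exch_lo, exch_hi] at h
      exact h1 h.symm
    rw [wordDelta_of_ne h3, wordDelta_of_ne h4]
    simp

/-- The indicator of the sorted word is the generator `v ⊗ 1` of the induced module; it provides the
`H_ν`-splitting of `altSumHom`. -/
theorem op_smul_wordDelta {ν : Composition n} {a : Hecke F n q}
    (ha : a ∈ parabolicSubalgebra F q ν) :
    op a • wordDelta F q ν.index = signChar F n q a • wordDelta F q ν.index := by
  induction ha using Algebra.adjoin_induction with
  | mem x hx =>
    obtain ⟨w, hw, rfl⟩ := hx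
    have hl := (isReducedWord_reducedWord w).index_eq hw
    rw [basisT]
    generalize reducedWord w = l at hl
    induction l with
    | nil => simp
    | cons i l ih =>
      rw [List.map_cons, List.prod_cons, op_mul, mul_smul, op_gen_smul_wordModule,
        wordAct_wordDelta (hl i (by simp)), smul_neg, ih fun j hj => hl j (by simp [hj]), map_mul,
        signChar_gen, neg_one_mul, neg_smul]
  | algebraMap c => rw [op_algebraMap_smul_wordModule, AlgHom.commutes]; rfl
  | add x y _ _ hx hy => rw [op_add, add_smul, hx, hy, map_add, add_smul]
  | mul x y _ _ hx hy =>
    rw [op_mul, mul_smul, hx, op_smul_smul_wordModule, hy, smul_smul, map_mul]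

theorem altSum_smul_wordDelta {f₀ : Fin n → Fin k} (hf₀ : Monotone f₀) (c : F) :
    altSum f₀ (c • wordDelta F q f₀) = c := by
  rw [altSum, Finset.sum_eq_single f₀]
  · change _ * (c * wordDelta F q f₀ f₀) = c
    rw [wordDelta_self, inversionCount_of_monotone hf₀, pow_zero, one_mul, mul_one]
  · intro f _ h
    change _ * (c * wordDelta F q f₀ f) = 0
    rw [wordDelta_of_ne h, mul_zero, mul_zero]
  · intro h
    exact absurd (mem_rearrangements.2 ⟨1, rfl⟩) h

/-- If the sign module is relatively projective for the parabolic subalgebra of `ν`, then the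
inversion sum of `ν` does not vanish. -/
theorem inversionSum_ne_zero_of_isRelativelyProjective (hq : q ≠ 0) {M : Type u}
    [AddCommGroup M] [Module (Hecke F n q)ᵐᵒᵖ M]
    (e : SignModule F n q ≃ₗ[(Hecke F n q)ᵐᵒᵖ] M) {ν : Composition n}
    (hM : IsRelativelyProjective (parabolicSubalgebra F q ν) M) :
    inversionSum q ν.index ≠ 0 := by
  have hmono := index_monotone ν
  let coord : M → F := fun x => e.symm x
  have hcoord : ∀ (a : Hecke F n q) (x : M), coord (op a • x) = signChar F n q a * coord x :=
    fun a x => by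
      change e.symm (op a • x) = _
      rw [map_smul, op_smul_signModule]
  -- The test surjection is the induced module over the sign module, and `x ↦ coord x • wordDelta`
  -- is its `H_ν`-splitting.
  obtain ⟨γ, hγ⟩ := hM (WordModule F n ν.length q) (SignModule F n q) (altSumHom F q ν.index)
    e.symm.toLinearMap
    (fun c => ⟨(show F from c) • wordDelta F q ν.index, altSum_smul_wordDelta (F := F) hmono c⟩)
    ⟨{ toFun := fun x => coord x • wordDelta F q ν.index
       map_add' := fun x y => by
         rw [← add_smul]
         congr 1
         exact map_add e.symm x y
       map_smul' := fun a x => by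
         obtain ⟨⟨a⟩, ha⟩ := a
         have ha : a ∈ parabolicSubalgebra F q ν := ha
         change coord (op a • x) • wordDelta F q ν.index = op a • coord x • wordDelta F q ν.index
         rw [hcoord, op_smul_smul_wordModule, op_smul_wordDelta ha, smul_smul, mul_comm] },
      fun x => altSum_smul_wordDelta (F := F) hmono (coord x)⟩
  let one : SignModule F n q := (1 : F)
  set φ := γ (e one) with hφ
  have hone : ∀ i, op (gen F n q i) • one = -one := fun i => by
    rw [op_smul_signModule, signChar_gen]
    exact neg_one_mul (1 : F)
  have hsign : ∀ i, wordAct F n ν.length q i φ = -φ := fun i => by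
    rw [← op_gen_smul_wordModule, hφ, ← map_smul, ← map_smul, hone, map_neg, map_neg]
  have h1 : altSum ν.index φ = 1 :=
    (hγ (e one)).trans (e.symm_apply_apply one)
  -- A sign vector has value `(-q⁻¹)^ℓ φ(f₀)` at a word with `ℓ` inversions; the signs cancel
  -- against those of `altSum`.
  have h2 : altSum ν.index φ = inversionSum q ν.index * φ ν.index := by
    rw [altSum, inversionSum, Finset.sum_mul]
    refine Finset.sum_congr rfl fun f hf => ?_
    rw [wordModule_apply_of_sign hq hsign hmono (mem_rearrangements.1 hf), ← mul_assoc, ← mul_pow]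
    simp
  intro h
  rw [h2, h, zero_mul] at h1
  exact zero_ne_one h1

theorem signModule_equiv_specht (hq : q ≠ 0) :
    Nonempty (SignModule F n q ≃ₗ[(Hecke F n q)ᵐᵒᵖ] Specht F q (Composition.ones n)) := by
  let g : SignModule F n q →ₗ[(Hecke F n q)ᵐᵒᵖ] Specht F q (Composition.ones n) :=
    { toFun := fun c => (show F from c) • spechtGen F n q
      map_add' := fun c d => add_smul (show F from c) (show F from d) _
      map_smul' := fun a c => by
        obtain ⟨a, rfl⟩ := op_surjective a
        rw [RingHom.id_apply, op_smul_specht hq, smul_smul]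
        rfl }
  refine ⟨LinearEquiv.ofBijective g ⟨?_, exists_smul_spechtGen hq⟩⟩
  exact fun c d h => smul_left_injective F spechtGen_ne_zero h

theorem isRelativelyProjective_specht_iff (hq : q ≠ 0) (ν : Composition n) :
    IsRelativelyProjective (parabolicSubalgebra F q ν) (Specht F q (Composition.ones n)) ↔
      inversionSum q ν.index ≠ 0 := by
  refine ⟨inversionSum_ne_zero_of_isRelativelyProjective hq (signModule_equiv_specht hq).some,
    isRelativelyProjective_of_inversionSum_ne_zero hq fun h x => ?_⟩
  rw [op_smul_specht hq, op_smul_specht hq, AlgHom.commutes]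
  rfl

end Necessity

/-! ### Gaussian binomial coefficients at a root of unity -/

section QBinom

variable {F : Type u} [Field F]

/-- The Gaussian binomial coefficient, evaluated at `x`. -/
def qBinom (x : F) : ℕ → ℕ → F
  | _, 0 => 1
  | 0, _ + 1 => 0
  | n + 1, k + 1 => qBinom x n k + x ^ (k + 1) * qBinom x n (k + 1)

theorem qBinom_zero_right (x : F) (n : ℕ) : qBinom x n 0 = 1 := by
  cases n <;> rfl

theorem qBinom_zero_succ (x : F) (k : ℕ) : qBinom x 0 (k + 1) = 0 := rfl

theorem qBinom_succ_succ (x : F) (n k : ℕ) :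
    qBinom x (n + 1) (k + 1) = qBinom x n k + x ^ (k + 1) * qBinom x n (k + 1) := rfl

theorem qBinom_of_lt (x : F) {n k : ℕ} (h : n < k) : qBinom x n k = 0 := by
  induction n generalizing k with
  | zero =>
    cases k with
    | zero => omega
    | succ k => rfl
  | succ n ih =>
    cases k with
    | zero => omega
    | succ k => rw [qBinom_succ_succ, ih (by omega), ih (by omega), mul_zero, add_zero]

/-- The `q`-analogue of `(k+1) C(n+1,k+1) = (n+1) C(n,k)`. It locates the zeros of the first `e`
rows and of row `e` without dividing by factorials that may vanish. -/
theorem sum_mul_qBinom (x : F) (n k : ℕ) :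
    (∑ i ∈ Finset.range (k + 1), x ^ i) * qBinom x (n + 1) (k + 1) =
      (∑ i ∈ Finset.range (n + 1), x ^ i) * qBinom x n k := by
  induction n generalizing k with
  | zero =>
    cases k with
    | zero => simp [qBinom]
    | succ k => simp [qBinom]
  | succ n ih =>
    have hs : ∀ m, ∑ i ∈ Finset.range (m + 1), x ^ i =
        1 + x * ∑ i ∈ Finset.range m, x ^ i := fun m => by
      rw [Finset.sum_range_succ', Finset.mul_sum, pow_zero, add_comm]
      simp only [pow_succ']
    have h1 := ih k
    cases k with
    | zero =>
      rw [qBinom_succ_succ, hs (n + 1)]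
      simp only [qBinom_zero_right, zero_add, Finset.sum_range_one, pow_zero, one_mul,
        pow_one] at h1 ⊢
      rw [h1]; ring
    | succ k =>
      have h2 := ih k
      rw [qBinom_succ_succ x (n + 1), hs (n + 1)]
      rw [hs (k + 1)] at h1 ⊢
      have h3 := qBinom_succ_succ x n k
      linear_combination (x ^ (k + 2)) * h1 + x * h2 -
        (x * ∑ i ∈ Finset.range (n + 1), x ^ i) * h3

variable {x : F} {e : ℕ}

theorem pow_eq_one_of_sum_eq_zero
    (h0 : ∑ i ∈ Finset.range e, x ^ i = 0) : x ^ e = 1 := by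
  have := geom_sum_mul x e
  rw [h0, zero_mul] at this
  exact (sub_eq_zero.1 this.symm)

theorem qBinom_ne_zero_of_lt
    (hne : ∀ k, 0 < k → k < e → ∑ i ∈ Finset.range k, x ^ i ≠ 0)
    {n k : ℕ} (hk : k ≤ n) (hn : n < e) : qBinom x n k ≠ 0 := by
  induction n generalizing k with
  | zero => rw [Nat.le_zero.1 hk, qBinom_zero_right]; exact one_ne_zero
  | succ n ih =>
    cases k with
    | zero => rw [qBinom_zero_right]; exact one_ne_zero
    | succ k =>
      intro h
      have h1 := sum_mul_qBinom x n k
      rw [h, mul_zero] at h1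
      exact mul_ne_zero (hne _ (by omega) hn) (ih (by omega) (by omega)) h1.symm

theorem qBinom_eq_zero_of_lt
    (h0 : ∑ i ∈ Finset.range e, x ^ i = 0)
    (hne : ∀ k, 0 < k → k < e → ∑ i ∈ Finset.range k, x ^ i ≠ 0)
    {k : ℕ} (hk : 0 < k) (hk' : k < e) : qBinom x e k = 0 := by
  obtain ⟨e, rfl⟩ := Nat.exists_eq_succ_of_ne_zero (by omega : e ≠ 0)
  obtain ⟨k, rfl⟩ := Nat.exists_eq_succ_of_ne_zero (by omega : k ≠ 0)
  have h1 := sum_mul_qBinom x e k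
  rw [h0, zero_mul] at h1
  exact (mul_eq_zero.1 h1).resolve_left (hne _ (by omega) hk')

/-- Row `e` of the triangle is `1, 0, …, 0, 1`, and the factors `x^(k+1)` of the Pascal recursion
have period `e`. Hence the rows from `e` on are the sum of two shifted copies of the triangle. -/
theorem qBinom_add_self (he : 0 < e) (h0 : ∑ i ∈ Finset.range e, x ^ i = 0)
    (hne : ∀ k, 0 < k → k < e → ∑ i ∈ Finset.range k, x ^ i ≠ 0) (n k : ℕ) :
    qBinom x (n + e) (k + e) = qBinom x n (k + e) + qBinom x n k ∧
      (k < e → qBinom x (n + e) k = qBinom x n k) := by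
  have hx := pow_eq_one_of_sum_eq_zero h0
  have diag : ∀ m, qBinom x m m = 1 := fun m => by
    induction m with
    | zero => rfl
    | succ m ih => rw [qBinom_succ_succ, ih, qBinom_of_lt x (Nat.lt_succ_self m)]; ring
  induction n generalizing k with
  | zero =>
    rw [zero_add]
    constructor
    · rw [qBinom_of_lt x (show 0 < k + e by omega), zero_add]
      cases k with
      | zero => rw [zero_add, diag]; rfl
      | succ k => rw [qBinom_of_lt x (by omega), qBinom_zero_succ]
    · intro hk
      cases k with
      | zero => rw [qBinom_zero_right, qBinom_zero_right]
      | succ k => rw [qBinom_eq_zero_of_lt h0 hne (by omega) hk, qBinom_zero_succ]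
  | succ n ih =>
    rw [show n + 1 + e = n + e + 1 by ring]
    constructor
    · cases k with
      | zero =>
        -- Column `e` draws on column `e - 1`, which is covered by the second assertion.
        obtain ⟨d, rfl⟩ := Nat.exists_eq_succ_of_ne_zero (by omega : e ≠ 0)
        have h1 := (ih 0).1
        have h2 := (ih d).2 (by omega)
        simp only [Nat.succ_eq_add_one, zero_add, qBinom_zero_right] at *
        rw [qBinom_succ_succ, qBinom_succ_succ, h1, h2, hx]
        ring
      | succ k =>
        have h1 := (ih k).1
        have h2 := (ih (k + 1)).1
        rw [show k + 1 + e = k + e + 1 by ring] at *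
        rw [qBinom_succ_succ, qBinom_succ_succ, qBinom_succ_succ, h1, h2,
          show k + e + 1 = k + 1 + e by ring, pow_add, hx]
        ring
    · intro hk
      cases k with
      | zero => rw [qBinom_zero_right, qBinom_zero_right]
      | succ k =>
        rw [qBinom_succ_succ, qBinom_succ_succ, (ih k).2 (by omega), (ih (k + 1)).2 hk]

/-- The Lucas theorem for Gaussian binomial coefficients. -/
theorem qBinom_lucas (he : 0 < e) (h0 : ∑ i ∈ Finset.range e, x ^ i = 0)
    (hne : ∀ k, 0 < k → k < e → ∑ i ∈ Finset.range k, x ^ i ≠ 0)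
    {b d : ℕ} (hb : b < e) (hd : d < e) (a c : ℕ) :
    qBinom x (b + e * a) (d + e * c) = (a.choose c : F) * qBinom x b d := by
  induction a generalizing c with
  | zero =>
    cases c with
    | zero => simp
    | succ c =>
      rw [qBinom_of_lt x (by rw [mul_add]; omega), Nat.choose_zero_succ, Nat.cast_zero, zero_mul]
  | succ a ih =>
    rw [mul_add, mul_one, ← add_assoc]
    cases c with
    | zero =>
      have := ih 0
      simp only [mul_zero, add_zero, Nat.choose_zero_right] at this ⊢
      rw [(qBinom_add_self he h0 hne _ _).2 hd, this]
    | succ c =>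
      have h1 := ih (c + 1)
      rw [mul_add, mul_one, ← add_assoc] at h1 ⊢
      rw [(qBinom_add_self he h0 hne _ _).1, h1, ih c, Nat.choose_succ_succ, Nat.cast_add]
      ring

theorem qBinom_ne_zero_iff (he : 0 < e) (h0 : ∑ i ∈ Finset.range e, x ^ i = 0)
    (hne : ∀ k, 0 < k → k < e → ∑ i ∈ Finset.range k, x ^ i ≠ 0) (p : ℕ) [CharP F p] (n k : ℕ) :
    qBinom x n k ≠ 0 ↔ k % e ≤ n % e ∧ ¬ p ∣ (n / e).choose (k / e) := by
  have h1 := qBinom_lucas he h0 hne (Nat.mod_lt n he) (Nat.mod_lt k he) (n / e) (k / e)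
  rw [Nat.mod_add_div, Nat.mod_add_div] at h1
  rw [h1, mul_ne_zero_iff, Ne, CharP.cast_eq_zero_iff F p, and_comm]
  refine and_congr_left fun _ => ⟨fun h => ?_, fun h => ?_⟩
  · by_contra h'
    exact h (qBinom_of_lt x (by omega))
  · exact qBinom_ne_zero_of_lt hne h (Nat.mod_lt n he)

end QBinom

/-! ### Gaussian multinomial coefficients count words by inversions -/

section QMultinom

variable {F : Type u} [Field F]

/-- The Gaussian multinomial coefficient, evaluated at `x`. -/
def qMultinom (x : F) : (k : ℕ) → (Fin k → ℕ) → F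
  | 0, _ => 1
  | k + 1, ν => qBinom x (∑ i, ν i) (ν 0) * qMultinom x k (Fin.tail ν)

theorem sum_update_pred {k : ℕ} (ν : Fin k → ℕ) {j : Fin k} (hj : 0 < ν j) :
    ∑ i, Function.update ν j (ν j - 1) i = ∑ i, ν i - 1 := by
  have h1 := Finset.add_sum_erase Finset.univ ν (Finset.mem_univ j)
  rw [Finset.sum_update_of_mem (Finset.mem_univ j), Finset.sdiff_singleton_eq_erase]
  omega

/-- The Pascal rule for multinomials, in the form needed for removing the first letter `j` of a
word: the exponent counts the letters smaller than `j`. -/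
theorem qMultinom_eq_sum (x : F) {k : ℕ} (ν : Fin k → ℕ) (hν : 0 < ∑ i, ν i) :
    qMultinom x k ν = ∑ j, if 0 < ν j then
      x ^ (∑ i, if i < j then ν i else 0) *
        qMultinom x k (Function.update ν j (ν j - 1)) else 0 := by
  induction k with
  | zero => simp at hν
  | succ k ih =>
    obtain ⟨M, hM⟩ := Nat.exists_eq_succ_of_ne_zero hν.ne'
    have hsum : ∀ j, 0 < ν j → ∑ i, Function.update ν j (ν j - 1) i = M := fun j hj => by
      rw [sum_update_pred ν hj, hM, Nat.succ_sub_one]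
    have hM' : ν 0 + ∑ i : Fin k, Fin.tail ν i = M + 1 :=
      (Fin.sum_univ_succ ν).symm.trans hM
    have hpascal : qBinom x (M + 1) (ν 0) = (if 0 < ν 0 then qBinom x M (ν 0 - 1) else 0) +
        x ^ ν 0 * qBinom x M (ν 0) := by
      cases ν 0 with
      | zero => simp [qBinom_zero_right]
      | succ a => simp [qBinom_succ_succ]
    rw [Fin.sum_univ_succ, qMultinom, hM, Nat.succ_eq_add_one, hpascal, add_mul]
    congr 1
    · split_ifs with h
      · rw [qMultinom, hsum _ h]
        simp
      · rw [zero_mul]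
    · by_cases ht : 0 < ∑ i, Fin.tail ν i
      · rw [ih _ ht, Finset.mul_sum]
        refine Finset.sum_congr rfl fun j _ => ?_
        by_cases hj : 0 < ν j.succ
        · have hj' : 0 < Fin.tail ν j := hj
          rw [if_pos hj, if_pos hj', qMultinom, hsum _ hj, Fin.tail_update_succ, Fin.sum_univ_succ,
            Function.update_of_ne (Fin.succ_ne_zero j).symm, if_pos (Fin.succ_pos j), pow_add]
          simp only [Fin.succ_lt_succ_iff, Fin.tail]
          ring
        · have hj' : ¬ 0 < Fin.tail ν j := hj
          rw [if_neg hj, if_neg hj', mul_zero]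
      -- All letters are 0 here, so `ν 0 = M + 1` and the second Pascal term vanishes.
      · rw [qBinom_of_lt x (show M < ν 0 by omega), mul_zero, zero_mul]
        symm
        refine Finset.sum_eq_zero fun j _ => if_neg fun hj => ht ?_
        exact lt_of_lt_of_le hj (Finset.single_le_sum (f := Fin.tail ν) (fun _ _ => Nat.zero_le _)
          (Finset.mem_univ j))

/-- The number of occurrences of a letter in a word. -/
def content {n k : ℕ} (f : Fin n → Fin k) (c : Fin k) : ℕ :=
  (Finset.univ.filter fun a => f a = c).card

theorem content_cons {n k : ℕ} (j : Fin k) (f : Fin n → Fin k) (c : Fin k) :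
    content (Fin.cons j f : Fin (n + 1) → Fin k) c = (if j = c then 1 else 0) + content f c := by
  rw [content, Fin.card_filter_univ_succ']
  rfl

theorem inversionCount_cons {n k : ℕ} (j : Fin k) (f : Fin n → Fin k) :
    inversionCount (Fin.cons j f : Fin (n + 1) → Fin k) =
      (∑ i, if i < j then content f i else 0) + inversionCount f := by
  have h : (∑ i, if i < j then content f i else 0) = ∑ a, if f a < j then 1 else 0 := by
    have h1 : ∀ i, (if i < j then content f i else 0) =
        ∑ a, if i < j then (if f a = i then 1 else 0) else 0 := fun i => by
      split_ifs
      · rw [content, Finset.card_filter]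
      · simp
    rw [Finset.sum_congr rfl fun i _ => h1 i, Finset.sum_comm]
    refine Finset.sum_congr rfl fun a _ => ?_
    rw [Finset.sum_eq_single (f a)]
    · simp
    · intro i _ hi
      simp [Ne.symm hi]
    · simp
  rw [h, inversionCount, inversionCount, Finset.card_filter, Finset.card_filter,
    Fintype.sum_prod_type, Fintype.sum_prod_type, Fin.sum_univ_succ]
  simp only [Fin.sum_univ_succ, Fin.cons_zero, Fin.cons_succ, Fin.not_lt_zero, Fin.succ_pos,
    Fin.succ_lt_succ_iff, true_and, false_and, if_false, zero_add]

theorem qMultinom_zero (x : F) (k : ℕ) : qMultinom x k (fun _ => 0) = 1 := by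
  induction k with
  | zero => rfl
  | succ k ih =>
    rw [qMultinom, qBinom_zero_right, one_mul]
    exact ih

/-- MacMahon's theorem. Both sides satisfy the same recursion in the first letter, by
`inversionCount_cons` and `qMultinom_eq_sum`. -/
theorem sum_pow_inversionCount (x : F) {n k : ℕ} (ν : Fin k → ℕ) (hν : ∑ i, ν i = n) :
    (∑ f : Fin n → Fin k, if content f = ν then x ^ inversionCount f else 0) =
      qMultinom x k ν := by
  induction n generalizing ν with
  | zero =>
    obtain rfl : ν = fun _ => 0 := funext fun i => by simpa using Finset.sum_eq_zero_iff.1 hν i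
    rw [qMultinom_zero, Fintype.sum_subsingleton _ Fin.elim0, if_pos]
    · simp [inversionCount]
    · funext c
      simp [content]
  | succ n ih =>
    rw [qMultinom_eq_sum x ν (by omega), ← (Fin.consEquiv fun _ => Fin k).sum_comp,
      Fintype.sum_prod_type]
    refine Finset.sum_congr rfl fun j _ => ?_
    split_ifs with hj
    · rw [← ih _ (by rw [sum_update_pred ν hj]; omega), Finset.mul_sum]
      refine Finset.sum_congr rfl fun f _ => ?_
      have hiff : content (Fin.cons j f : Fin (n + 1) → Fin k) = ν ↔
          content f = Function.update ν j (ν j - 1) := by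
        simp only [funext_iff, content_cons]
        refine forall_congr' fun c => ?_
        by_cases hc : j = c
        · subst hc; simp; omega
        · simp [hc, Function.update_of_ne (Ne.symm hc)]
      change (if content (Fin.cons j f : Fin (n + 1) → Fin k) = ν then
        x ^ inversionCount (Fin.cons j f : Fin (n + 1) → Fin k) else 0) = _
      simp only [hiff, mul_ite, mul_zero]
      split_ifs with h
      · rw [inversionCount_cons, pow_add, h]
        congr 2
        refine Finset.sum_congr rfl fun i _ => ?_
        split_ifs with hi
        · rw [Function.update_of_ne hi.ne]
        · rfl
      · rfl
    · refine Finset.sum_eq_zero fun f _ => if_neg fun h => hj ?_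
      rw [← h]
      change 0 < content (Fin.cons j f : Fin (n + 1) → Fin k) j
      rw [content_cons, if_pos rfl]
      omega

end QMultinom

/-! ### The parts of the standard maximal composition -/

section Parts

variable {p : ℕ}

/-- The parts `m p^i`, with multiplicities the base `p` digits of `N`. -/
def digitParts (p m N : ℕ) : Multiset ℕ := digitBlocks p m (Nat.digits p N)

/-- The parts of the standard maximal composition of `n`. -/
def standardParts (e p n : ℕ) : Multiset ℕ :=
  Multiset.replicate (n % e) 1 + digitParts p e (n / e)

theorem blocks_standardMaximal {e n : ℕ} (he : 0 < e) (hp : 0 < p) :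
    ((standardMaximal e p n he hp).blocks : Multiset ℕ) = standardParts e p n := rfl

theorem sum_standardParts {e : ℕ} (he : 0 < e) (hp : 0 < p) (n : ℕ) :
    (standardParts e p n).sum = n := by
  rw [← blocks_standardMaximal he hp, Multiset.sum_coe, Composition.blocks_sum]

theorem digitParts_zero (m : ℕ) : digitParts p m 0 = 0 := by
  simp [digitParts, digitBlocks]

theorem digitParts_eq (hp : 1 < p) (m N : ℕ) :
    digitParts p m N = Multiset.replicate (N % p) m + digitParts p (m * p) (N / p) := by
  rcases Nat.eq_zero_or_pos N with rfl | hN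
  · simp [digitParts_zero]
  · rw [digitParts, Nat.digits_def' hp hN, digitBlocks, ← Multiset.coe_add,
      Multiset.coe_replicate]
    rfl

/-- The hypothesis excludes a carry from the last digit, since a carry would make the last digit of
the sum smaller than that of `A`. -/
theorem mod_add_and_div_add {A B e : ℕ} (he : 0 < e) (h : A % e ≤ (A + B) % e) :
    (A + B) % e = A % e + B % e ∧ (A + B) / e = A / e + B / e := by
  have hA := Nat.mod_lt A he
  have hB := Nat.mod_lt B he
  rw [Nat.add_mod] at h
  have hlt : A % e + B % e < e := by
    by_contra hc
    have h1 := Nat.mod_eq_sub_mod (not_lt.1 hc)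
    rw [Nat.mod_eq_of_lt (show A % e + B % e - e < e by omega)] at h1
    omega
  rw [Nat.add_mod, Nat.mod_eq_of_lt hlt, Nat.add_div he, if_neg (by omega)]
  exact ⟨rfl, rfl⟩

/-- By Lucas, nonvanishing modulo `p` means that no carry occurs, so the digits of `A` and `B` add
place by place. -/
theorem digitParts_add [hp : Fact p.Prime] {A B : ℕ} (h : ¬ p ∣ (A + B).choose A) (m : ℕ) :
    digitParts p m (A + B) = digitParts p m A + digitParts p m B := by
  induction hN : A + B using Nat.strong_induction_on generalizing A B m with
  | _ N ih =>
    subst hN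
    rcases Nat.eq_zero_or_pos (A + B) with h0 | h0
    · obtain ⟨rfl, rfl⟩ := Nat.add_eq_zero_iff.1 h0
      simp [digitParts_zero]
    have h1 := Choose.choose_modEq_choose_mod_mul_choose_div_nat (n := A + B) (k := A) (p := p)
    rw [(h1.dvd_iff dvd_rfl), hp.out.dvd_mul, not_or] at h
    have hle : A % p ≤ (A + B) % p := by
      by_contra hc
      rw [Nat.choose_eq_zero_of_lt (not_le.1 hc)] at h
      exact h.1 (dvd_zero p)
    obtain ⟨hm, hd⟩ := mod_add_and_div_add hp.out.pos hle
    have h2 := h.2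
    rw [hd] at h2
    rw [digitParts_eq hp.out.one_lt m (A + B), digitParts_eq hp.out.one_lt m A,
      digitParts_eq hp.out.one_lt m B, hm, hd, Multiset.replicate_add,
      ih _ (by rw [← hd]; exact Nat.div_lt_self h0 hp.out.one_lt) h2 _ rfl]
    abel

theorem choose_mul_pow_dvd_iff [hp : Fact p.Prime] (i N K : ℕ) :
    p ∣ (p ^ i * N).choose (p ^ i * K) ↔ p ∣ N.choose K := by
  induction i with
  | zero => simp
  | succ i ih =>
    have h1 := Choose.choose_modEq_choose_mod_mul_choose_div_nat
      (n := p ^ (i + 1) * N) (k := p ^ (i + 1) * K) (p := p)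
    rw [h1.dvd_iff dvd_rfl, pow_succ', mul_assoc, mul_assoc, Nat.mul_mod_right,
      Nat.mul_mod_right, Nat.choose_self, one_mul, Nat.mul_div_cancel_left _ hp.out.pos,
      Nat.mul_div_cancel_left _ hp.out.pos, ih]

variable {F : Type u} [Field F] [hp : Fact p.Prime] [CharP F p] {x : F} {e : ℕ}

theorem standardParts_add (he : 0 < e) (h0 : ∑ i ∈ Finset.range e, x ^ i = 0)
    (hne : ∀ k, 0 < k → k < e → ∑ i ∈ Finset.range k, x ^ i ≠ 0) {A B : ℕ}
    (h : qBinom x (A + B) A ≠ 0) :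
    standardParts e p (A + B) = standardParts e p A + standardParts e p B := by
  obtain ⟨h1, h2⟩ := (qBinom_ne_zero_iff he h0 hne p _ _).1 h
  obtain ⟨hm, hd⟩ := mod_add_and_div_add he h1
  rw [hd] at h2
  rw [standardParts, hm, hd, digitParts_add h2, Multiset.replicate_add, standardParts,
    standardParts]
  abel

theorem standardParts_sum (he : 0 < e) (h0 : ∑ i ∈ Finset.range e, x ^ i = 0)
    (hne : ∀ k, 0 < k → k < e → ∑ i ∈ Finset.range k, x ^ i ≠ 0) {k : ℕ} {ν : Fin k → ℕ}
    (h : qMultinom x k ν ≠ 0) :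
    standardParts e p (∑ c, ν c) = ∑ c, standardParts e p (ν c) := by
  induction k with
  | zero => simp [standardParts, digitParts_zero]
  | succ k ih =>
    obtain ⟨h1, h2⟩ := mul_ne_zero_iff.1 h
    have h3 := ih h2
    rw [Fin.sum_univ_succ] at h1
    rw [Fin.sum_univ_succ, Fin.sum_univ_succ, standardParts_add he h0 hne h1]
    congr 1

theorem qMultinom_get_cons (m : ℕ) (L : List ℕ) :
    qMultinom x (m :: L).length (m :: L).get =
      qBinom x (m + L.sum) m * qMultinom x L.length L.get := by
  have : ∑ i, (m :: L).get i = m + L.sum := by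
    rw [← List.sum_ofFn, List.ofFn_get, List.sum_cons]
  change qBinom x (∑ i, (m :: L).get i) m * _ = _
  rw [this]
  rfl

/-- Removing the parts one by one, smallest first, each factor chooses `e p^i` from `e p^i (a + 1 +
p r)`; up to a power of `p` scaling both entries this is `a + 1` modulo `p`, where `a + 1` is at
most a digit. -/
theorem qMultinom_digitBlocks_ne_zero (he : 0 < e) (h0 : ∑ i ∈ Finset.range e, x ^ i = 0)
    (hne : ∀ k, 0 < k → k < e → ∑ i ∈ Finset.range k, x ^ i ≠ 0) (l : List ℕ)
    (hl : ∀ a ∈ l, a < p) (i : ℕ) :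
    qMultinom x (digitBlocks p (e * p ^ i) l).length (digitBlocks p (e * p ^ i) l).get ≠ 0 := by
  induction l generalizing i with
  | nil => exact one_ne_zero
  | cons a l ih =>
    have hR := ih (fun b hb => hl b (List.mem_cons_of_mem _ hb)) (i + 1)
    have ha : a < p := hl a List.mem_cons_self
    rw [digitBlocks]
    have hsum := sum_digitBlocks p l (e * p ^ i * p)
    rw [pow_succ, ← mul_assoc] at hR
    generalize digitBlocks p (e * p ^ i * p) l = R at hR hsum
    induction a with
    | zero => exact hR
    | succ a iha =>
      rw [List.replicate_succ, List.cons_append, qMultinom_get_cons]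
      refine mul_ne_zero ?_ (iha (by
        intro b hb
        rcases List.mem_cons.1 hb with rfl | hb
        · omega
        · exact hl b (List.mem_cons_of_mem _ hb)) (by omega))
      rw [List.sum_append, List.sum_replicate, hsum, smul_eq_mul, qBinom_ne_zero_iff he h0 hne p,
        show e * p ^ i + (a * (e * p ^ i) + e * p ^ i * p * Nat.ofDigits p l) =
          e * (p ^ i * (a + 1 + p * Nat.ofDigits p l)) by ring, Nat.mul_mod_right,
        Nat.mul_mod_right, Nat.mul_div_cancel_left _ he, Nat.mul_div_cancel_left _ he]
      refine ⟨le_rfl, ?_⟩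
      have := choose_mul_pow_dvd_iff (p := p) i (a + 1 + p * Nat.ofDigits p l) 1
      rw [mul_one] at this
      rw [this, Nat.choose_one_right, Nat.dvd_add_left (dvd_mul_right _ _)]
      exact Nat.not_dvd_of_pos_of_lt (Nat.succ_pos a) ha

theorem qMultinom_standardMaximal_ne_zero (he : 0 < e)
    (h0 : ∑ i ∈ Finset.range e, x ^ i = 0)
    (hne : ∀ k, 0 < k → k < e → ∑ i ∈ Finset.range k, x ^ i ≠ 0) (n : ℕ) :
    qMultinom x (standardMaximal e p n he hp.out.pos).length
      (standardMaximal e p n he hp.out.pos).blocksFun ≠ 0 := by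
  have hR := qMultinom_digitBlocks_ne_zero he h0 hne (Nat.digits p (n / e))
    (fun a ha => Nat.digits_lt_base hp.out.one_lt ha) 0
  have hsum := sum_digitBlocks p (Nat.digits p (n / e)) e
  rw [pow_zero, mul_one] at hR
  change qMultinom x (List.replicate (n % e) 1 ++ digitBlocks p e (Nat.digits p (n / e))).length
    (List.replicate (n % e) 1 ++ digitBlocks p e (Nat.digits p (n / e))).get ≠ 0
  have ha := Nat.mod_lt n he
  generalize digitBlocks p e (Nat.digits p (n / e)) = R at hR hsum
  generalize n % e = a at ha
  induction a with
  | zero => exact hR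
  | succ a iha =>
    rw [List.replicate_succ, List.cons_append, qMultinom_get_cons]
    refine mul_ne_zero ?_ (iha (by omega))
    -- A nonzero remainder modulo `e` forces `1 < e`. The part 1 then lives in the last digit only
    -- and the classical binomial factor has lower entry 0.
    have he1 : 1 < e := by omega
    rw [List.sum_append, List.sum_replicate, hsum, smul_eq_mul, qBinom_ne_zero_iff he h0 hne p,
      mul_one, ← add_assoc, Nat.add_mul_mod_self_left, Nat.mod_eq_of_lt he1,
      Nat.mod_eq_of_lt (by omega), Nat.div_eq_of_lt he1, Nat.choose_zero_right]
    exact ⟨by omega, hp.out.one_lt.not_ge ∘ Nat.le_of_dvd one_pos⟩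

end Parts

/-! ### Conjugacy of parabolic subgroups -/

section Conjugacy

variable {n : ℕ}

theorem content_index (ν : Composition n) : content ν.index = ν.blocksFun := by
  funext c
  have : (Finset.univ.filter fun a => ν.index a = c) =
      Finset.univ.map (ν.embedding c).toEmbedding := by
    ext a
    rw [Finset.mem_filter, Finset.mem_map]
    have := ν.mem_range_embedding_iff' (j := a) (i := c)
    simpa [eq_comm] using this.symm
  rw [content, this, Finset.card_map, Finset.card_univ, Fintype.card_fin]

theorem exists_rearrangement_iff {k : ℕ} {f g : Fin n → Fin k} :
    (∃ σ : Equiv.Perm (Fin n), f = g ∘ σ) ↔ content f = content g := by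
  refine ⟨?_, fun h => ?_⟩
  swap
  · obtain ⟨σ, hσ⟩ := exists_equiv_of_card_fiber fun c => congrFun h c
    exact ⟨σ, funext hσ⟩
  rintro ⟨σ, rfl⟩
  funext c
  refine Finset.card_bij (fun a _ => σ a) ?_ ?_ ?_
  · intro a ha; simpa using ha
  · intro a _ b _ h; exact σ.injective h
  · intro b hb; exact ⟨σ.symm b, by simpa using hb, by simp⟩

/-- The rearrangements of `ν.index` are the words whose content is given by the parts of `ν`, so the
trace scalar is a multinomial coefficient. -/
theorem inversionSum_index {F : Type u} [Field F] (q : F) (ν : Composition n) :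
    inversionSum q ν.index = qMultinom q⁻¹ ν.length ν.blocksFun := by
  rw [← sum_pow_inversionCount q⁻¹ ν.blocksFun ν.sum_blocksFun, inversionSum, rearrangements,
    Finset.sum_filter]
  refine Finset.sum_congr rfl fun f _ => ?_
  rw [← content_index]
  exact if_congr exists_rearrangement_iff rfl rfl

/-- A decomposition of the multiset of the values of a function comes from a decomposition of
its domain. -/
theorem exists_fiber_sum_eq {ι κ : Type*} [Fintype ι] [Fintype κ] [DecidableEq κ] (f : ι → ℕ)
    (t : κ → Multiset ℕ) (h : Finset.univ.val.map f = ∑ c, t c) :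
    ∃ r : ι → κ, ∀ c, ∑ i, (if r i = c then f i else 0) = (t c).sum := by
  -- The disjoint union of the multisets, with multiplicities, is compared with the domain of `f`
  -- through the sizes of the fibres over each value.
  let g : (Σ c, t c) → ℕ := fun x => x.2.1
  have hc : ∀ b, (Finset.univ.filter fun a => f a = b).card =
      (Finset.univ.filter fun a => g a = b).card := by
    intro b
    have h1 := congrArg (Multiset.count b) h
    rw [Multiset.count_map, Multiset.count_sum'] at h1
    have h2 : (Finset.univ.filter fun a => g a = b).card = ∑ c, Multiset.count b (t c) := by
      rw [Finset.card_filter, Fintype.sum_sigma]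
      refine Finset.sum_congr rfl fun c _ => ?_
      have h3 := congrArg (Multiset.count b) (Multiset.map_univ_coe (t c))
      rw [← h3, Multiset.count_map, ← Finset.card_filter, Finset.card_def, Finset.filter_val]
      simp only [g, eq_comm]
    rw [h2, ← h1, Finset.card_def, Finset.filter_val]
    simp only [eq_comm]
  obtain ⟨σ, hσ⟩ := exists_equiv_of_card_fiber hc
  refine ⟨fun i => (σ i).1, fun c => ?_⟩
  simp only [hσ]
  rw [σ.sum_comp (fun x => if x.1 = c then g x else 0), Fintype.sum_sigma,
    Finset.sum_eq_single c]
  · simp only [g, if_true]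
    have h3 := congrArg Multiset.sum (Multiset.map_univ_coe (t c))
    exact h3
  · intro d _ hd
    simp [hd]
  · simp

/-- Merging the blocks of `μ` along `r` gives a word with the content of `ν.index`. A permutation
that carries one word to the other conjugates `S_μ`, which fixes the merged word, into `S_ν`. -/
theorem exists_conj_parabolic_le {μ ν : Composition n} (r : Fin μ.length → Fin ν.length)
    (hr : ∀ c, ∑ i, (if r i = c then μ.blocksFun i else 0) = ν.blocksFun c) :
    ∃ x : Equiv.Perm (Fin n), (parabolic μ).map (MulAut.conj x).toMonoidHom ≤ parabolic ν := by
  have hcont : content (r ∘ μ.index) = content ν.index := by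
    rw [content_index]
    funext c
    rw [← hr c, content, ← content_index μ]
    simp only [content, Finset.card_filter]
    have h1 : ∀ i, (if r i = c then ∑ a, (if μ.index a = i then 1 else 0) else 0) =
        ∑ a, if r i = c then (if μ.index a = i then 1 else 0) else 0 := fun i => by
      split_ifs
      · rfl
      · simp
    rw [Finset.sum_congr rfl fun i _ => h1 i, Finset.sum_comm]
    refine Finset.sum_congr rfl fun a _ => ?_
    rw [Finset.sum_eq_single (μ.index a)]
    · simp
    · intro i _ hi
      simp [Ne.symm hi]
    · simp
  obtain ⟨σ, hσ⟩ := exists_rearrangement_iff.2 hcont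
  refine ⟨σ, ?_⟩
  rintro _ ⟨w, hw, rfl⟩ a
  have h1 : ∀ b, ν.index (σ b) = r (μ.index b) := fun b => (congrFun hσ b).symm
  change ν.index (σ (w (σ⁻¹ a))) = ν.index a
  rw [h1, hw, ← h1]
  exact congrArg _ (σ.apply_symm_apply a)

end Conjugacy

/-! ### Passage from `q` to `q⁻¹`, and the vertex of the sign module -/

theorem sum_pow_inv_eq_zero_iff {F : Type u} [Field F] {q : F} (hq : q ≠ 0) (k : ℕ) :
    ∑ i ∈ Finset.range k, q⁻¹ ^ i = 0 ↔ ∑ i ∈ Finset.range k, q ^ i = 0 := by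
  -- Reversing the order of summation, `i ↦ k - 1 - i`.
  have h : ∑ i ∈ Finset.range k, q ^ i = q ^ (k - 1) * ∑ i ∈ Finset.range k, q⁻¹ ^ i := by
    rw [← Finset.sum_range_reflect, Finset.mul_sum]
    refine Finset.sum_congr rfl fun i hi => ?_
    have := Finset.mem_range.1 hi
    rw [pow_sub₀ q hq (by omega), inv_pow]
  rw [h, mul_eq_zero, or_iff_right (pow_ne_zero _ hq)]

end IwahoriHecke

theorem mainTheorem6 {F : Type u} [Field F] (p : ℕ) [hp : Fact p.Prime] [CharP F p]
    (q : F) (hq : q ≠ 0) (he : 1 < IwahoriHecke.quantumChar q) (n : ℕ) (hn : 1 ≤ n) :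
    (Module.finrank F (IwahoriHecke.Specht F q (Composition.ones n)) = 1 ∧
      ∀ (i : Fin (n - 1)) (x : IwahoriHecke.Specht F q (Composition.ones n)),
        MulOpposite.op (IwahoriHecke.gen F n q i) • x = -x) ∧
    IwahoriHecke.IsVertex F q (IwahoriHecke.Specht F q (Composition.ones n))
      (IwahoriHecke.standardMaximal (IwahoriHecke.quantumChar q) p n
        (lt_trans Nat.zero_lt_one he) hp.out.pos) := by
  open IwahoriHecke in
  have he0 : 0 < quantumChar q := lt_trans Nat.zero_lt_one he
  -- Positivity rules out the default value 0 of the infimum, so the infimum is attained.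
  have hspec : 0 < quantumChar q ∧ ∑ i ∈ Finset.range (quantumChar q), q ^ i = 0 :=
    Nat.sInf_mem (Nat.nonempty_of_pos_sInf he0)
  have h0 := (sum_pow_inv_eq_zero_iff hq _).2 hspec.2
  have hne : ∀ k, 0 < k → k < quantumChar q → ∑ i ∈ Finset.range k, q⁻¹ ^ i ≠ 0 :=
    fun k hk hlt h => Nat.notMem_of_lt_sInf hlt ⟨hk, (sum_pow_inv_eq_zero_iff hq k).1 h⟩
  refine ⟨⟨finrank_specht hq, fun i x => ?_⟩, ?_, fun ν hν => ?_⟩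
  · rw [op_smul_specht hq, signChar_gen]
    exact neg_one_smul F x
  · rw [isRelativelyProjective_specht_iff hq, inversionSum_index]
    exact qMultinom_standardMaximal_ne_zero he0 h0 hne n
  · rw [isRelativelyProjective_specht_iff hq, inversionSum_index] at hν
    -- The parts of `λ` are thus the union of the standard parts of the `ν_c`, and the group
    -- belonging to `c` sums to `ν_c`; `r` records the grouping.
    have hsum := standardParts_sum (p := p) he0 h0 hne hν
    rw [ν.sum_blocksFun, ← blocks_standardMaximal he0 hp.out.pos, ← Composition.ofFn_blocksFun,
      ← Fin.univ_val_map] at hsum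
    obtain ⟨r, hr⟩ := exists_fiber_sum_eq _ _ hsum
    exact exists_conj_parabolic_le r fun c => (hr c).trans (sum_standardParts he0 hp.out.pos _)
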